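/- Let $X$ be a (real or complex) Hilbert space and let $A\colon D(A)\subset X\to X$ be self-adjoint and bounded from below, i.e. for some $c\in\mathbb R$, $\langle Ax,x\rangle\ge c|x|^2$ for all $x\in D(A)$. Let $e^{-At}$, $t\ge 0$, denote the strongly continuous semigroup with generator $-A$. Let $\bar k\in[0,\infty)$ be such that $\operatorname{re}\sigma(B)>0$, where $B:=A+\bar kI$, and let $X^\beta$, $\beta\ge 0$, be the fractional power spaces generated by $B$: $B^{0}=I$, $B^{-\beta}u=\Gamma(\beta)^{-1}\int_0^\infty t^{\beta-1}e^{-Bt}u\,dt$ for $u\in X$, $\beta>0$; $X^\beta$ is the range of the injective operator $B^{-\beta}$, $B^\beta\colon X^\beta\to X$ is its inverse, and $|u|_{X^\beta}=|B^\beta u|_X$. Let $\alpha\in[0,1)$ and let $g\colon X^\alpha\to X$ be Lipschitz continuous on every bounded subset of $X^\alpha$. Let $\pi$ be the local semiflow on $X^\alpha$ generated by the solutions of $$\dot u+Au=g(u);$$ that is, $x\pi t$ is defined if and only if $t\ge 0$ and there is a solution $u\colon[0,T)\to X^\alpha$ with $t<T$ and $u(0)=x$, and then $x\pi t=u(t)$.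 Here a solution on $[0,T)$ is a map $u$ that is continuous from $[0,T)$ into $X^\alpha$ and satisfies the equation, either in the classical sense (for $0<t<T$: $u(t)\in D(A)$, $u$ is differentiable at $t$ into $X$, and $\dot u(t)+Au(t)=g(u(t))$) or in the mild sense ($u(t)=e^{-At}u(0)+\int_0^te^{-A(t-s)}g(u(s))\,ds$ for $0\le t<T$); the assertion below is made for each of these two readings of "solution". A set $K\subset X^\alpha$ is called $\pi$-invariant if for every $x\in K$ there is a map $\sigma\colon\mathbb R\to K$ with $\sigma(0)=x$ such that $\sigma(t)\pi s$ is defined and equals $\sigma(t+s)$ for all $t\in\mathbb R$, $s\ge 0$. If $K\subset X^\alpha$ is $\pi$-invariant and compact in $X^\alpha$, then $K\subset X^1=D(A)$ and $K$ is compact in $X^1$. -/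

import Mathlib

open Set Filter Topology MeasureTheory
open scoped NNReal InnerProductSpace

noncomputable section

namespace Parabolic

section Operators

variable {𝕜 X : Type*} [RCLike 𝕜] [NormedAddCommGroup X] [InnerProductSpace 𝕜 X]

/-- An operator `A : D(A) ⊂ X → X` is bounded from below:
`⟨A x, x⟩ ≥ c ‖x‖²` on `D(A)` for some real `c`. -/
def BoundedBelow (A : X →ₗ.[𝕜] X) : Prop :=
  ∃ c : ℝ, ∀ x : A.domain, c * ‖(x : X)‖ ^ 2 ≤ RCLike.re (inner 𝕜 (A x) (x : X))

/-- The operator `A + k I`, with domain `D(A)`. -/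
def shift (A : X →ₗ.[𝕜] X) (k : ℝ) : X →ₗ.[𝕜] X :=
  ((k : 𝕜) • (LinearMap.id : X →ₗ[𝕜] X)) +ᵥ A

/-- The resolvent set of an unbounded operator: those `z` for which `A - z I : D(A) → X` has a
bounded everywhere defined two-sided inverse `R`. -/
def resolventSet (A : X →ₗ.[𝕜] X) : Set 𝕜 :=
  {z | ∃ R : X →L[𝕜] X,
    (∀ x : X, ∃ h : R x ∈ A.domain, A ⟨R x, h⟩ - z • R x = x) ∧
    ∀ x : A.domain, R (A x - z • (x : X)) = x}

/-- The spectrum of an unbounded operator. (For a self-adjoint operator on a real Hilbert space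
the spectrum of the complexification is real and coincides with this set.) -/
def spectrum (A : X →ₗ.[𝕜] X) : Set 𝕜 := (resolventSet A)ᶜ

/-- `S` (of which only the values at `t ≥ 0` matter) is a strongly continuous semigroup of bounded
linear operators. -/
structure IsC0Semigroup (S : ℝ → X →L[𝕜] X) : Prop where
  zero : S 0 = ContinuousLinearMap.id 𝕜 X
  add : ∀ s t : ℝ, 0 ≤ s → 0 ≤ t → S (s + t) = (S s).comp (S t)
  cont : ∀ x : X, ContinuousOn (fun t => S t x) (Ici 0)

variable [NormedSpace ℝ X]

/-- The operator `G` is the infinitesimal generator of `S`: `x ∈ D(G)` and `G x = y` if and only if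
`(S(t) x - x) / t → y` as `t → 0+`. -/
def IsGenerator (G : X →ₗ.[𝕜] X) (S : ℝ → X →L[𝕜] X) : Prop :=
  ∀ x y : X, (∃ h : x ∈ G.domain, G ⟨x, h⟩ = y) ↔
    Tendsto (fun t : ℝ => t⁻¹ • (S t x - x)) (𝓝[>] 0) (𝓝 y)

open Classical in
/-- The semigroup `e^{-At}`, `t ≥ 0`: the strongly continuous semigroup whose generator is `-A`
(unique at `t ≥ 0` when it exists; junk value `0` when there is none). -/
def semigroup (A : X →ₗ.[𝕜] X) (t : ℝ) : X →L[𝕜] X :=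
  if h : ∃ S : ℝ → X →L[𝕜] X, IsC0Semigroup S ∧ IsGenerator (-A) S then h.choose t else 0

/-- The fractional power `B^{-α}`, `α ≥ 0`: the identity for `α = 0` and
`B^{-α} u = Γ(α)⁻¹ ∫₀^∞ t^{α-1} e^{-Bt} u dt` for `α > 0`. -/
def negPow (B : X →ₗ.[𝕜] X) (α : ℝ) (u : X) : X :=
  if α = 0 then u
  else (Real.Gamma α)⁻¹ • ∫ t in Ioi (0 : ℝ), t ^ (α - 1) • semigroup B t u

/-- The fractional power space `X^α` generated by `B`: the range of `B^{-α}`. -/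
def FracSpace (B : X →ₗ.[𝕜] X) (α : ℝ) : Type _ := {x : X // x ∈ range (negPow B α)}

namespace FracSpace

variable {B : X →ₗ.[𝕜] X} {α : ℝ}

/-- The inclusion `X^α ⊂ X`. -/
def incl (u : FracSpace B α) : X := u.1

/-- The operator `B^α : X^α → X`, inverse to `B^{-α}`. -/
def pow (u : FracSpace B α) : X := u.2.choose

theorem negPow_pow (u : FracSpace B α) : negPow B α u.pow = u.incl := u.2.choose_spec

theorem pow_injective : Function.Injective (pow : FracSpace B α → X) := fun u v h =>
  Subtype.ext (by
    have hu := negPow_pow u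
    rw [h, negPow_pow v] at hu
    exact hu.symm)

/-- The metric of the norm `|u|_{X^α} = ‖B^α u‖`, that is `d(u, v) = ‖B^α u - B^α v‖`
(`B^α` is linear). -/
instance : MetricSpace (FracSpace B α) := MetricSpace.induced pow pow_injective inferInstance

theorem dist_eq (u v : FracSpace B α) : dist u v = ‖u.pow - v.pow‖ := dist_eq_norm u.pow v.pow

end FracSpace

/-- `g` is Lipschitz continuous on every bounded subset. -/
def LipschitzOnBounded {Y Z : Type*} [MetricSpace Y] [MetricSpace Z] (g : Y → Z) : Prop :=
  ∀ s : Set Y, Bornology.IsBounded s → ∃ L : ℝ≥0, LipschitzOnWith L g s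

variable {B : X →ₗ.[𝕜] X} {α : ℝ}

/-- `u` is a classical solution of `u' + A u = g(u)` on `[0, T)`: it is continuous on `[0, T)` into
`X^α` and, for `0 < t < T`, `u(t) ∈ D(A)`, `u` is differentiable at `t` into `X` and the equation
holds. -/
def IsClassicalSolution (A : X →ₗ.[𝕜] X) (g : FracSpace B α → X) (T : ℝ)
    (u : ℝ → FracSpace B α) : Prop :=
  ContinuousOn u (Ico 0 T) ∧
    ∀ t ∈ Ioo 0 T, ∃ h : (u t).incl ∈ A.domain,
      HasDerivAt (fun s => (u s).incl) (g (u t) - A ⟨(u t).incl, h⟩) t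

/-- `u` is a mild solution of `u' + A u = g(u)` on `[0, T)`: it is continuous on `[0, T)` into
`X^α` and satisfies the variation of constants formula
`u(t) = e^{-At} u(0) + ∫₀^t e^{-A(t-s)} g(u(s)) ds`. -/
def IsMildSolution (A : X →ₗ.[𝕜] X) (g : FracSpace B α → X) (T : ℝ)
    (u : ℝ → FracSpace B α) : Prop :=
  ContinuousOn u (Ico 0 T) ∧
    ∀ t ∈ Ico 0 T, (u t).incl =
      semigroup A t (u 0).incl + ∫ s in (0 : ℝ)..t, semigroup A (t - s) (g (u s))

end Operators

section Semiflow

variable {Y : Type*}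

/-- The local semiflow generated by a notion `Sol T u` of solution on `[0, T)` for which solutions
are unique: `x π t` is defined (for `t ≥ 0`) if and only if there is a solution `u` with `u(0) = x`
on some interval `[0, T)` containing `t`, and then `x π t = u(t)`. -/
def localSemiflow (Sol : ℝ → (ℝ → Y) → Prop) (t : ℝ) (x : Y) : Part Y where
  Dom := 0 ≤ t ∧ ∃ u : ℝ → Y, u 0 = x ∧ ∃ T : ℝ, t < T ∧ Sol T u
  get h := h.2.choose t

/-- `σ : ℝ → Y` is a full solution of `π`: for `t ∈ ℝ` and `s ≥ 0`, `σ(t) π s` is defined and equal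
to `σ(t + s)`. -/
def IsFullSolution (π : ℝ → Y → Part Y) (σ : ℝ → Y) : Prop :=
  ∀ t s : ℝ, 0 ≤ s → σ (t + s) ∈ π s (σ t)

/-- `K` is `π`-invariant: through every point of `K` there is a full solution lying in `K`. -/
def IsInvariant (π : ℝ → Y → Part Y) (K : Set Y) : Prop :=
  ∀ x ∈ K, ∃ σ : ℝ → Y, IsFullSolution π σ ∧ (∀ t, σ t ∈ K) ∧ σ 0 = x

end Semiflow

end Parabolic

end

/-!
Every point of an invariant set `K` is `u(1)` for a solution `u` with `u(0) ∈ K` that stays in `K`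
on `[0, 1]`. For solutions that stay in the compact set `K`, the time one map `u(0) ↦ u(1)` is
continuous from `X^α` into `X^1` (`IsParabolic.exists_modulus`). Hence `K`, seen in `X^1`, is the
continuous image of the compact set `K ⊂ X^α` (`IsParabolic.isCompact_of_arcs`).

Smoothing of the time one map. Let `S(t) = e^{-At}` and `B = A + k`. On `K` the nonlinearity `g` is
bounded and Lipschitz, so a singular Gronwall inequality gives Lipschitz dependence of
`w = B^α u` on `w(0)` (`IsParabolic.exists_lipschitz`), and the variation of constants formula gives
Hölder continuity of `w` at `t = 1`, with exponent `θ = (1 - α) / 2` and a uniform constant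
(`IsParabolic.norm_sub_le`). Consequently, with `G(s) = g(u(s))`,
`B u(1) = B S(1) u(0) + ∫₀¹ B S(1 - s) (G(s) - G(1)) ds + (B ∫₀¹ S(s) ds) G(1)`
converges although `‖B S(t)‖` is only bounded by a multiple of `t⁻¹`. For two solutions at initial
distance `δ`, the increments `G(s) - G(1)` differ by at most a multiple of both `(1 - s)^θ` and `δ`,
hence of `√δ (1 - s)^{θ/2}`, so that the integrals differ by at most a multiple of `√δ`
(`IsParabolic.norm_regularValue_sub_le`).

The linear theory comes from the continuous functional calculus of the bounded symmetric operator
`R = B⁻¹`, which is positive because `B` has no spectrum in `(-∞, 0]`. It is built here for real and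
complex spaces at once (`exists_functionalCalculus`), from the estimate `‖p(R)‖ ≤ sup |p|` for real
polynomials. The operators `e^{-tB}`, `B^{-a}` and `B^a e^{-tB}` have the symbols `e^{-t/r}`, `r^a`
and `r^{-a} e^{-t/r}`; the smoothing estimates and the Gamma integral for `B^{-a}` are statements
about these functions. A strongly continuous semigroup is determined by its generator, which
identifies `semigroup A` with the semigroup so constructed, and the same product rule for
`s ↦ S(t - s) u(s)` shows that classical solutions are mild.
-/

noncomputable section

namespace Parabolic

/-! ### Functional calculus of a bounded symmetric operator -/

section FunctionalCalculus

variable {𝕜 X : Type*} [RCLike 𝕜] [NormedAddCommGroup X] [InnerProductSpace 𝕜 X]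

/-- The Cauchy–Schwarz inequality for the form of a positive operator `N`, applied to `x` and
`N x`. -/
theorem norm_sq_le_of_nonneg {N : X →L[𝕜] X} (hs : ∀ x y, inner 𝕜 (N x) y = inner 𝕜 x (N y))
    (hp : ∀ x, 0 ≤ RCLike.re (inner 𝕜 (N x) x)) (x : X) :
    ‖N x‖ ^ 2 ≤ (‖N‖ + 1) * RCLike.re (inner 𝕜 (N x) x) := by
  set M := ‖N‖ + 1 with hM
  have hM0 : 0 < M := by positivity
  have h := hp (x - ((M⁻¹ : ℝ) : 𝕜) • N x)
  have h2 : RCLike.re (inner 𝕜 (N (N x)) (N x)) ≤ ‖N‖ * ‖N x‖ ^ 2 := by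
    calc _ ≤ ‖N (N x)‖ * ‖N x‖ := re_inner_le_norm _ _
      _ ≤ ‖N‖ * ‖N x‖ * ‖N x‖ := by gcongr; exact N.le_opNorm _
      _ = _ := by ring
  have h3 : RCLike.re (inner 𝕜 (N (x - ((M⁻¹ : ℝ) : 𝕜) • N x)) (x - ((M⁻¹ : ℝ) : 𝕜) • N x)) =
      RCLike.re (inner 𝕜 (N x) x) - 2 * M⁻¹ * ‖N x‖ ^ 2 +
        M⁻¹ ^ 2 * RCLike.re (inner 𝕜 (N (N x)) (N x)) := by
    rw [map_sub, map_smul, inner_sub_left, inner_sub_right, inner_sub_right]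
    simp only [hs (N x) x, inner_smul_left, inner_smul_right, RCLike.conj_ofReal, map_sub,
      RCLike.re_ofReal_mul, inner_self_eq_norm_sq]
    ring
  rw [h3] at h
  have h4 : M⁻¹ ^ 2 * RCLike.re (inner 𝕜 (N (N x)) (N x)) ≤ M⁻¹ * ‖N x‖ ^ 2 := by
    calc _ ≤ M⁻¹ ^ 2 * (M * ‖N x‖ ^ 2) := by
          gcongr; exact h2.trans (by gcongr; linarith)
      _ = _ := by field_simp
  have h5 : M⁻¹ * ‖N x‖ ^ 2 ≤ RCLike.re (inner 𝕜 (N x) x) := by linarith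
  rwa [inv_mul_le_iff₀ hM0] at h5

/-- A bounded symmetric operator bounded below by a positive constant is invertible. -/
theorem isUnit_of_coercive [CompleteSpace X] {N : X →L[𝕜] X} {c : ℝ} (hc : 0 < c)
    (h : ∀ x, c * ‖x‖ ^ 2 ≤ RCLike.re (inner 𝕜 (N x) x)) : IsUnit N := by
  refine ContinuousLinearMap.isUnit_of_forall_le_norm_inner_map N (c := ⟨c, hc.le⟩) hc fun x => ?_
  have := (h x).trans (RCLike.re_le_norm _)
  rw [mul_comm]; exact this

variable [NormedSpace ℝ X] [IsScalarTower ℝ 𝕜 X]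

theorem real_smul_eq (r : ℝ) (x : X) : r • x = (r : 𝕜) • x := by
  rw [← algebraMap_smul 𝕜 r x]

theorem algebraMap_clm_apply (m : ℝ) (x : X) :
    (algebraMap ℝ (X →L[𝕜] X) m) x = (m : 𝕜) • x := by
  rw [Algebra.algebraMap_eq_smul_one, _root_.smul_apply, real_smul_eq (𝕜 := 𝕜)]
  simp

theorem re_inner_sub_algebraMap (N : X →L[𝕜] X) (m : ℝ) (x : X) :
    RCLike.re (inner 𝕜 ((N - algebraMap ℝ (X →L[𝕜] X) m) x) x) =
      RCLike.re (inner 𝕜 (N x) x) - m * ‖x‖ ^ 2 := by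
  rw [_root_.sub_apply, algebraMap_clm_apply, inner_sub_left, inner_smul_left,
    inner_self_eq_norm_sq_to_K]
  rw [map_sub, RCLike.conj_ofReal, RCLike.re_ofReal_mul, ← RCLike.ofReal_pow, RCLike.ofReal_re]

theorem re_inner_algebraMap_sub (N : X →L[𝕜] X) (m : ℝ) (x : X) :
    RCLike.re (inner 𝕜 ((algebraMap ℝ (X →L[𝕜] X) m - N) x) x) =
      m * ‖x‖ ^ 2 - RCLike.re (inner 𝕜 (N x) x) := by
  rw [← neg_sub, _root_.neg_apply, inner_neg_left, map_neg, re_inner_sub_algebraMap]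
  ring

/-- A bounded symmetric operator without negative spectrum is positive: the infimum `m` of its
numerical range cannot satisfy `m < 0`, since `N - m` would be positive with a bounded inverse,
hence coercive. -/
theorem re_inner_nonneg_of_isUnit {N : X →L[𝕜] X}
    (hs : ∀ x y, inner 𝕜 (N x) y = inner 𝕜 x (N y))
    (hu : ∀ m : ℝ, m < 0 → IsUnit (N - algebraMap ℝ (X →L[𝕜] X) m)) (x : X) :
    0 ≤ RCLike.re (inner 𝕜 (N x) x) := by
  by_contra! hx
  set S : Set ℝ := {c | ∀ y, c * ‖y‖ ^ 2 ≤ RCLike.re (inner 𝕜 (N y) y)} with hS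
  have hx0 : 0 < ‖x‖ ^ 2 := by
    rcases eq_or_ne x 0 with rfl | h
    · simp at hx
    · positivity
  have hne : S.Nonempty := ⟨-‖N‖, fun y => by
    have h1 := (abs_le.1 (RCLike.abs_re_le_norm (inner 𝕜 (N y) y))).1
    have h2 := norm_inner_le_norm (𝕜 := 𝕜) (N y) y
    have h3 : ‖N y‖ * ‖y‖ ≤ ‖N‖ * ‖y‖ * ‖y‖ := by gcongr; exact N.le_opNorm _
    nlinarith⟩
  have hle : ∀ c ∈ S, c ≤ RCLike.re (inner 𝕜 (N x) x) / ‖x‖ ^ 2 := fun c hc => by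
    rw [le_div_iff₀ hx0]; exact hc x
  have hbdd : BddAbove S := ⟨_, hle⟩
  have hm0 : sSup S < 0 := (csSup_le hne hle).trans_lt (div_neg_of_neg_of_pos hx hx0)
  set m := sSup S with hm
  have hmS : m ∈ S := fun y => by
    rcases (sq_nonneg ‖y‖).eq_or_lt with h | h
    · have : y = 0 := by simpa using h.symm
      simp [this]
    · rw [← le_div_iff₀ h]
      refine csSup_le hne fun c hc => ?_
      rw [le_div_iff₀ h]; exact hc y
  have hs' : ∀ y z, inner 𝕜 ((N - algebraMap ℝ (X →L[𝕜] X) m) y) z =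
      inner 𝕜 y ((N - algebraMap ℝ (X →L[𝕜] X) m) z) := fun y z => by
    simp only [_root_.sub_apply, algebraMap_clm_apply, inner_sub_left,
      inner_sub_right, hs, inner_smul_left, inner_smul_right, RCLike.conj_ofReal]
  obtain ⟨u, hu'⟩ := hu m hm0
  set N' := N - algebraMap ℝ (X →L[𝕜] X) m with hN'
  have hp' : ∀ y, 0 ≤ RCLike.re (inner 𝕜 (N' y) y) := fun y => by
    rw [hN', re_inner_sub_algebraMap]; linarith [hmS y]
  set V : X →L[𝕜] X := ↑u⁻¹ with hV
  set D := (‖N'‖ + 1) * (‖V‖ ^ 2 + 1) with hD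
  have hD0 : 0 < D := by positivity
  have hmem : m + D⁻¹ ∈ S := fun y => by
    have h1 := norm_sq_le_of_nonneg hs' hp' y
    have h2 : ‖y‖ ≤ ‖V‖ * ‖N' y‖ := by
      have : V (N' y) = y := by
        rw [← hu', hV, ← mul_apply_eq_comp, Units.inv_mul]; rfl
      calc ‖y‖ = ‖V (N' y)‖ := by rw [this]
        _ ≤ _ := V.le_opNorm _
    have h3 : ‖y‖ ^ 2 ≤ D * RCLike.re (inner 𝕜 (N' y) y) := by
      calc ‖y‖ ^ 2 ≤ (‖V‖ * ‖N' y‖) ^ 2 := by gcongr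
        _ ≤ (‖V‖ ^ 2 + 1) * ‖N' y‖ ^ 2 := by rw [mul_pow]; gcongr; linarith
        _ ≤ (‖V‖ ^ 2 + 1) * ((‖N'‖ + 1) * RCLike.re (inner 𝕜 (N' y) y)) := by gcongr
        _ = _ := by rw [hD]; ring
    rw [hN', re_inner_sub_algebraMap, ← inv_mul_le_iff₀ hD0] at h3
    linarith
  have := le_csSup hbdd hmem
  have : 0 < D⁻¹ := inv_pos.2 hD0
  linarith

variable [CompleteSpace X]

open Polynomial in
/-- The polynomial spectral mapping property of a symmetric operator with `0 ≤ T ≤ b`: a real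
polynomial without zeros in `[0, b]` takes `T` to an invertible operator. Over `ℝ` it is enough to
consider linear factors and quadratic factors without real roots. -/
theorem isUnit_aeval {T : X →L[𝕜] X} (hs : ∀ x y, inner 𝕜 (T x) y = inner 𝕜 x (T y))
    (hp : ∀ x, 0 ≤ RCLike.re (inner 𝕜 (T x) x)) {b : ℝ} (hb : ‖T‖ ≤ b) (p : ℝ[X])
    (h0 : ∀ r ∈ Icc 0 b, p.eval r ≠ 0) : IsUnit (aeval T p) := by
  have hb0 : 0 ≤ b := (norm_nonneg _).trans hb
  have hTb : ∀ x, RCLike.re (inner 𝕜 (T x) x) ≤ b * ‖x‖ ^ 2 := fun x => by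
    calc _ ≤ ‖T x‖ * ‖x‖ := re_inner_le_norm _ _
      _ ≤ b * ‖x‖ * ‖x‖ := by gcongr; exact (T.le_opNorm _).trans (by gcongr)
      _ = _ := by ring
  have hlin : ∀ l : ℝ, l ∉ Icc 0 b → IsUnit (T - algebraMap ℝ (X →L[𝕜] X) l) := fun l hl => by
    rcases lt_or_ge l 0 with h | h
    · refine isUnit_of_coercive (c := -l) (by linarith) fun x => ?_
      rw [re_inner_sub_algebraMap]; linarith [hp x]
    · have hl' : b < l := by
        by_contra! h'
        exact hl ⟨h, h'⟩
      rw [← neg_sub, IsUnit.neg_iff]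
      refine isUnit_of_coercive (c := l - b) (by linarith) fun x => ?_
      rw [re_inner_algebraMap_sub]; linarith [hTb x]
  induction p using WfDvdMonoid.induction_on_irreducible with
  | zero => exact absurd (eval_zero) (h0 0 ⟨le_rfl, hb0⟩)
  | unit u hu => exact hu.map (aeval T)
  | mul q p _ hirr ih =>
    rw [map_mul]
    refine IsUnit.mul ?_ (ih fun r hr h => h0 r hr (by simp [h]))
    have hp0 : ∀ r ∈ Icc 0 b, p.eval r ≠ 0 := fun r hr h => h0 r hr (by simp [h])
    rw [eq_quadratic_of_degree_le_two hirr.degree_le_two] at hp0 ⊢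
    by_cases ha : p.coeff 2 = 0
    · rw [ha] at hp0 ⊢
      by_cases hc : p.coeff 1 = 0
      · have hd := hp0 0 ⟨le_rfl, hb0⟩
        rw [hc] at hd ⊢
        simp only [map_zero, zero_mul, zero_add, aeval_C]
        refine IsUnit.map _ (isUnit_iff_ne_zero.2 ?_)
        simpa using hd
      · have h1 : -(p.coeff 0) / p.coeff 1 ∉ Icc 0 b := fun h => hp0 _ h (by
          simp; field_simp; ring)
        have h2 := (IsUnit.map (algebraMap ℝ (X →L[𝕜] X)) (isUnit_iff_ne_zero.2 hc)).mul
          (hlin _ h1)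
        convert h2 using 1
        rw [mul_sub, ← map_mul, mul_div_cancel₀ _ hc]
        simp
    · -- no real root at all: otherwise `p` would be reducible
      have hroot : ∀ r, p.eval r ≠ 0 := fun r hr => by
        have := degree_eq_one_of_irreducible_of_root hirr hr
        exact ha (coeff_eq_zero_of_degree_lt (by rw [this]; norm_num))
      set a := p.coeff 2
      set c := p.coeff 1
      set d := p.coeff 0
      have hev : ∀ r, p.eval r = a * r ^ 2 + c * r + d := fun r => by
        conv_lhs => rw [eq_quadratic_of_degree_le_two hirr.degree_le_two]
        simp [a, c, d]
      set s := c / (2 * a) with hs_def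
      set e := d / a - s ^ 2 with he_def
      have he : 0 < e := by
        by_contra! he
        refine hroot (Real.sqrt (-e) - s) ?_
        rw [hev]
        have h1 := Real.sq_sqrt (show 0 ≤ -e by linarith)
        have : a * (Real.sqrt (-e) - s) ^ 2 + c * (Real.sqrt (-e) - s) + d =
            a * (Real.sqrt (-e) ^ 2 + e) := by
          rw [he_def, hs_def]; field_simp; ring
        rw [this, h1]; ring
      have h2 : IsUnit ((T + algebraMap ℝ (X →L[𝕜] X) s) ^ 2 + algebraMap ℝ (X →L[𝕜] X) e) := by
        refine isUnit_of_coercive he fun x => ?_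
        have h3 := re_inner_sub_algebraMap ((T + algebraMap ℝ (X →L[𝕜] X) s) ^ 2) (-e) x
        rw [map_neg, sub_neg_eq_add] at h3
        rw [h3]
        have h4 : RCLike.re (inner 𝕜 (((T + algebraMap ℝ (X →L[𝕜] X) s) ^ 2) x) x) =
            ‖(T + algebraMap ℝ (X →L[𝕜] X) s) x‖ ^ 2 := by
          have h5 : ∀ y z, inner 𝕜 ((T + algebraMap ℝ (X →L[𝕜] X) s) y) z =
              inner 𝕜 y ((T + algebraMap ℝ (X →L[𝕜] X) s) z) := fun y z => by
            simp only [_root_.add_apply, algebraMap_clm_apply, inner_add_left,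
              inner_add_right, hs, inner_smul_left, inner_smul_right, RCLike.conj_ofReal]
          rw [pow_two, mul_apply_eq_comp, h5, inner_self_eq_norm_sq]
        rw [h4]
        nlinarith [sq_nonneg ‖(T + algebraMap ℝ (X →L[𝕜] X) s) x‖]
      have h3 := (IsUnit.map (algebraMap ℝ (X →L[𝕜] X)) (isUnit_iff_ne_zero.2 ha)).mul h2
      have h5 : C a * Polynomial.X ^ 2 + C c * Polynomial.X + C d =
          C a * ((Polynomial.X + C s) ^ 2 + C e) := by
        have hc : c = a * (2 * s) := by rw [hs_def]; field_simp
        have hd : d = a * (s ^ 2 + e) := by rw [he_def]; field_simp; ring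
        rw [hc, hd]; simp only [map_mul, map_add, map_pow, map_ofNat]; ring
      rw [h5]
      simpa using h3

open Polynomial in
/-- The norm bound `‖p(T)‖ ≤ sup_{[0, b]} |p|` for a symmetric operator with `0 ≤ T ≤ b`. -/
theorem norm_aeval_le {T : X →L[𝕜] X} (hs : ∀ x y, inner 𝕜 (T x) y = inner 𝕜 x (T y))
    (hp : ∀ x, 0 ≤ RCLike.re (inner 𝕜 (T x) x)) {b : ℝ} (hb : ‖T‖ ≤ b) (p : ℝ[X]) {c : ℝ}
    (hc : 0 ≤ c) (h : ∀ r ∈ Icc 0 b, |p.eval r| ≤ c) : ‖aeval T p‖ ≤ c := by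
  have hsym : ∀ q : ℝ[X], ∀ x y, inner 𝕜 (aeval T q x) y = inner 𝕜 x (aeval T q y) := by
    intro q
    induction q using Polynomial.induction_on' with
    | add q₁ q₂ h₁ h₂ =>
      intro x y
      simp only [map_add, _root_.add_apply, inner_add_left, inner_add_right, h₁, h₂]
    | monomial n a =>
      have hpow : ∀ n : ℕ, ∀ x y, inner 𝕜 ((T ^ n) x) y = inner 𝕜 x ((T ^ n) y) := by
        intro n
        induction n with
        | zero => intro x y; simp
        | succ n ih =>
          intro x y
          conv_lhs => rw [pow_succ]
          rw [pow_succ', mul_apply_eq_comp, mul_apply_eq_comp, ih, hs]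
      intro x y
      simp only [aeval_monomial, mul_apply_eq_comp, algebraMap_clm_apply,
        inner_smul_left, inner_smul_right, RCLike.conj_ofReal, hpow]
  refine ContinuousLinearMap.opNorm_le_bound _ hc fun x => ?_
  have hq := re_inner_nonneg_of_isUnit (hsym (C (c ^ 2) - p ^ 2)) (fun m hm => by
    rw [← aeval_C T m, ← map_sub]
    refine isUnit_aeval hs hp hb _ fun r hr => ?_
    have : p.eval r ^ 2 ≤ c ^ 2 := sq_le_sq' (abs_le.1 (h r hr)).1 (abs_le.1 (h r hr)).2
    simp only [eval_sub, eval_C, eval_pow]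
    exact (by linarith : 0 < c ^ 2 - p.eval r ^ 2 - m).ne') x
  rw [map_sub, aeval_C, re_inner_algebraMap_sub, map_pow, pow_two (aeval T p),
    mul_apply_eq_comp, hsym, inner_self_eq_norm_sq] at hq
  refine le_of_sq_le_sq ?_ (by positivity)
  rw [mul_pow]; linarith

open Polynomial in
/-- The continuous functional calculus of a symmetric operator with `0 ≤ T ≤ b`, on a real or
complex Hilbert space. -/
theorem exists_functionalCalculus {T : X →L[𝕜] X}
    (hs : ∀ x y, inner 𝕜 (T x) y = inner 𝕜 x (T y))
    (hp : ∀ x, 0 ≤ RCLike.re (inner 𝕜 (T x) x)) {b : ℝ} (hb : ‖T‖ ≤ b) :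
    ∃ φ : C(Icc (0 : ℝ) b, ℝ) →L[ℝ] (X →L[𝕜] X), (∀ f, ‖φ f‖ ≤ ‖f‖) ∧
      (∀ f g, φ (f * g) = φ f * φ g) ∧ φ 1 = 1 ∧
      φ ((ContinuousMap.id ℝ).restrict (Icc 0 b)) = T := by
  set e : ℝ[X] →ₗ[ℝ] C(Icc (0 : ℝ) b, ℝ) := (toContinuousMapOnAlgHom (Icc (0 : ℝ) b)).toLinearMap
  set f : ℝ[X] →ₗ[ℝ] (X →L[𝕜] X) := (aeval T).toLinearMap
  have hd : DenseRange e := by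
    intro g
    have := continuousMap_mem_polynomialFunctions_closure 0 b g
    rw [← SetLike.mem_coe, Subalgebra.topologicalClosure_coe, polynomialFunctions_coe] at this
    exact this
  have hn : ∀ p, ‖f p‖ ≤ 1 * ‖e p‖ := fun p => by
    rw [one_mul]
    refine norm_aeval_le hs hp hb p (norm_nonneg _) fun r hr => ?_
    exact (e p).norm_coe_le_norm ⟨r, hr⟩
  have heq : ∀ p, f.extendOfNorm e (e p) = aeval T p := fun p =>
    LinearMap.extendOfNorm_eq hd ⟨1, hn⟩ p
  refine ⟨f.extendOfNorm e, fun g => ?_, fun g₁ g₂ => ?_, ?_, ?_⟩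
  · simpa using LinearMap.norm_extendOfNorm_apply_le hd 1 hn g
  · refine hd.induction_on₂ (p := fun g₁ g₂ => f.extendOfNorm e (g₁ * g₂) =
      f.extendOfNorm e g₁ * f.extendOfNorm e g₂) ?_ ?_ g₁ g₂
    · exact isClosed_eq (by fun_prop) (by fun_prop)
    · intro p q
      have : e p * e q = e (p * q) := (map_mul (toContinuousMapOnAlgHom (Icc (0 : ℝ) b)) p q).symm
      rw [this, heq, heq, heq, map_mul]
  · have : (1 : C(Icc (0 : ℝ) b, ℝ)) = e 1 :=
      (map_one (toContinuousMapOnAlgHom (Icc (0 : ℝ) b))).symm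
    rw [this, heq, map_one]
  · have : (ContinuousMap.id ℝ).restrict (Icc 0 b) = e Polynomial.X := by
      ext r; simp [e]
    rw [this, heq, aeval_X]

end FunctionalCalculus

/-! ### Symbols of the fractional powers and of the semigroup -/

section Kernel

/-- The symbol `r ↦ r^{-a} e^{-t/r}` of `B^a e^{-tB}` in the functional calculus of `R = B⁻¹`,
extended by `0` to `r ≤ 0`. -/
def kernelFun (a t r : ℝ) : ℝ := if r ≤ 0 then 0 else r ^ (-a) * Real.exp (-(t / r))

theorem kernelFun_of_nonpos {a t r : ℝ} (hr : r ≤ 0) : kernelFun a t r = 0 := if_pos hr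

theorem kernelFun_of_pos {a t r : ℝ} (hr : 0 < r) :
    kernelFun a t r = r ^ (-a) * Real.exp (-(t / r)) := if_neg hr.not_ge

theorem kernelFun_nonneg (a t r : ℝ) : 0 ≤ kernelFun a t r := by
  unfold kernelFun
  split_ifs with h
  · exact le_rfl
  · have : 0 < r := not_le.1 h
    positivity

/-- With `y = t / r` this is the bound `y^a e^{-y} ≤ 2`. -/
theorem kernelFun_le {a t : ℝ} (ha : a ∈ Icc (0 : ℝ) 2) (ht : 0 < t) (r : ℝ) :
    kernelFun a t r ≤ 2 * t ^ (-a) := by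
  rcases le_or_gt r 0 with hr | hr
  · rw [kernelFun_of_nonpos hr]; positivity
  rw [kernelFun_of_pos hr]
  set y := t / r with hy
  have hy0 : 0 < y := by positivity
  have hr' : r ^ (-a) = t ^ (-a) * y ^ a := by
    rw [hy, Real.div_rpow ht.le hr.le, Real.rpow_neg ht.le, Real.rpow_neg hr.le]
    have := (Real.rpow_pos_of_pos ht a).ne'
    field_simp
  have hya : y ^ a ≤ 2 * Real.exp y := by
    rcases le_total y 1 with h | h
    · have h1 := Real.rpow_le_one hy0.le h ha.1
      have h2 := Real.one_le_exp hy0.le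
      linarith
    · have h1 : y ^ a ≤ y ^ (2 : ℝ) := Real.rpow_le_rpow_of_exponent_le h ha.2
      rw [Real.rpow_two] at h1
      have h2 := Real.quadratic_le_exp_of_nonneg hy0.le
      linarith
  have h1 : y ^ a * Real.exp (-y) ≤ 2 := by
    rw [Real.exp_neg, ← div_eq_mul_inv, div_le_iff₀ (Real.exp_pos y)]; exact hya
  rw [hr', mul_assoc, mul_comm 2]
  gcongr

theorem one_sub_exp_neg_le_rpow {x θ : ℝ} (hx : 0 ≤ x) (hθ : θ ∈ Icc (0 : ℝ) 1) :
    1 - Real.exp (-x) ≤ x ^ θ := by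
  rcases le_total x 1 with h | h
  · have h1 := Real.add_one_le_exp (-x)
    rcases hx.eq_or_lt with rfl | hx'
    · simpa using Real.rpow_nonneg le_rfl θ
    have h2 := Real.rpow_le_rpow_of_exponent_ge hx' h hθ.2
    rw [Real.rpow_one] at h2
    linarith
  · have h1 := Real.one_le_rpow h hθ.1
    have h2 := Real.exp_pos (-x)
    linarith

/-- The Hölder bound in time: `r^{-a} e^{-t/r} (1 - e^{-h/r}) ≤ h^θ r^{-(a + θ)} e^{-t/r}`. -/
theorem abs_kernelFun_sub_le {a θ t h : ℝ} (ha : a ∈ Icc (0 : ℝ) 1) (hθ : θ ∈ Icc (0 : ℝ) 1)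
    (ht : 0 < t) (hh : 0 ≤ h) (r : ℝ) :
    |kernelFun a (t + h) r - kernelFun a t r| ≤ 2 * h ^ θ * t ^ (-(a + θ)) := by
  rcases le_or_gt r 0 with hr | hr
  · rw [kernelFun_of_nonpos hr, kernelFun_of_nonpos hr]; simp; positivity
  have h1 := kernelFun_le (a := a + θ) ⟨by linarith [ha.1, hθ.1], by linarith [ha.2, hθ.2]⟩ ht r
  rw [kernelFun_of_pos hr] at h1
  rw [kernelFun_of_pos hr, kernelFun_of_pos hr, abs_sub_comm]
  have h2 : r ^ (-a) * Real.exp (-(t / r)) - r ^ (-a) * Real.exp (-((t + h) / r)) =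
      r ^ (-a) * Real.exp (-(t / r)) * (1 - Real.exp (-(h / r))) := by
    rw [add_div, neg_add, Real.exp_add]; ring
  have h3 : 0 ≤ 1 - Real.exp (-(h / r)) := by
    have : Real.exp (-(h / r)) ≤ 1 := Real.exp_le_one_iff.2 (by simp; positivity)
    linarith
  rw [h2, abs_of_nonneg (by positivity)]
  calc _ ≤ r ^ (-a) * Real.exp (-(t / r)) * (h / r) ^ θ := by
        gcongr; exact one_sub_exp_neg_le_rpow (by positivity) hθ
    _ = h ^ θ * (r ^ (-(a + θ)) * Real.exp (-(t / r))) := by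
        rw [Real.div_rpow hh hr.le, neg_add, Real.rpow_add hr, Real.rpow_neg hr.le θ]
        ring
    _ ≤ h ^ θ * (2 * t ^ (-(a + θ))) := by gcongr
    _ = _ := by ring

theorem continuous_kernelFun {a t : ℝ} (ha : a ∈ Icc (0 : ℝ) 1) (ht : 0 < t) :
    Continuous (kernelFun a t) := by
  rw [continuous_iff_continuousAt]
  intro r
  rcases lt_trichotomy r 0 with hr | rfl | hr
  · have : kernelFun a t =ᶠ[𝓝 r] fun _ => 0 := by
      filter_upwards [Iio_mem_nhds hr] with x hx using kernelFun_of_nonpos (le_of_lt hx)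
    exact continuousAt_const.congr this.symm
  · rw [ContinuousAt, kernelFun_of_nonpos le_rfl]
    have hb : ∀ r, kernelFun a t r ≤ |r| * (2 * t ^ (-(a + 1))) := fun r => by
      rcases le_or_gt r 0 with hr | hr
      · rw [kernelFun_of_nonpos hr]; positivity
      · have := kernelFun_le (a := a + 1) ⟨by linarith [ha.1], by linarith [ha.2]⟩ ht r
        rw [abs_of_pos hr]
        calc kernelFun a t r = r * kernelFun (a + 1) t r := by
              rw [kernelFun_of_pos hr, kernelFun_of_pos hr, neg_add, Real.rpow_add hr,
                Real.rpow_neg_one]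
              field_simp
          _ ≤ _ := by gcongr
    refine squeeze_zero (fun r => kernelFun_nonneg a t r) hb ?_
    have : Continuous fun r : ℝ => |r| * (2 * t ^ (-(a + 1))) := by fun_prop
    simpa using this.tendsto 0
  · have : (fun x => x ^ (-a) * Real.exp (-(t / x))) =ᶠ[𝓝 r] kernelFun a t := by
      filter_upwards [Ioi_mem_nhds hr] with x hx using (kernelFun_of_pos hx).symm
    refine ContinuousAt.congr ?_ this
    have h1 : ContinuousAt (fun x : ℝ => x ^ (-a)) r :=
      Real.continuousAt_rpow_const _ _ (.inl hr.ne')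
    have h2 : ContinuousAt (fun x : ℝ => t / x) r := continuousAt_const.div continuousAt_id hr.ne'
    exact h1.mul h2.neg.rexp

/-- The symbol of `B^a e^{-tB}`, for `0 ≤ a ≤ 1` and `t > 0`, as a continuous function on the
interval `[0, b]` that contains the spectrum of `B⁻¹` (junk value `0` for other `a`, `t`). -/
def kernel (b a t : ℝ) : C(Icc (0 : ℝ) b, ℝ) :=
  if h : a ∈ Icc (0 : ℝ) 1 ∧ 0 < t then
    ⟨fun r => kernelFun a t r, (continuous_kernelFun h.1 h.2).comp continuous_subtype_val⟩
  else 0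

variable {b : ℝ}

theorem kernel_apply {a t : ℝ} (ha : a ∈ Icc (0 : ℝ) 1) (ht : 0 < t) (r : Icc (0 : ℝ) b) :
    kernel b a t r = kernelFun a t r := by
  rw [kernel, dif_pos ⟨ha, ht⟩]; rfl

theorem zero_mem_Icc_zero_one : (0 : ℝ) ∈ Icc (0 : ℝ) 1 := ⟨le_rfl, zero_le_one⟩

theorem one_mem_Icc_zero_one : (1 : ℝ) ∈ Icc (0 : ℝ) 1 := ⟨zero_le_one, le_rfl⟩

theorem norm_kernel_le {a t : ℝ} (ha : a ∈ Icc (0 : ℝ) 1) (ht : 0 < t) :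
    ‖kernel b a t‖ ≤ 2 * t ^ (-a) := by
  refine (ContinuousMap.norm_le _ (by positivity)).2 fun r => ?_
  rw [kernel_apply ha ht, Real.norm_of_nonneg (kernelFun_nonneg _ _ _)]
  exact kernelFun_le ⟨ha.1, by linarith [ha.2]⟩ ht r

theorem norm_kernel_sub_le {a θ t h : ℝ} (ha : a ∈ Icc (0 : ℝ) 1) (hθ : θ ∈ Icc (0 : ℝ) 1)
    (ht : 0 < t) (hh : 0 ≤ h) :
    ‖kernel b a (t + h) - kernel b a t‖ ≤ 2 * h ^ θ * t ^ (-(a + θ)) := by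
  refine (ContinuousMap.norm_le _ (by positivity)).2 fun r => ?_
  rw [ContinuousMap.sub_apply, kernel_apply ha (by linarith), kernel_apply ha ht, Real.norm_eq_abs]
  exact abs_kernelFun_sub_le ha hθ ht hh r

theorem norm_kernel_zero_le_exp {t : ℝ} (ht : 0 < t) :
    ‖kernel b 0 t‖ ≤ Real.exp (-(t / b)) := by
  refine (ContinuousMap.norm_le _ (by positivity)).2 fun r => ?_
  rw [kernel_apply zero_mem_Icc_zero_one ht, Real.norm_of_nonneg (kernelFun_nonneg _ _ _)]
  rcases le_or_gt (r : ℝ) 0 with hr | hr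
  · rw [kernelFun_of_nonpos hr]; positivity
  · rw [kernelFun_of_pos hr]
    have := r.2.2
    simp only [neg_zero, Real.rpow_zero, one_mul, Real.exp_le_exp, neg_le_neg_iff]
    gcongr

theorem kernel_mul_kernel {a s t : ℝ} (ha : a ∈ Icc (0 : ℝ) 1) (hs : 0 < s) (ht : 0 < t) :
    kernel b a s * kernel b 0 t = kernel b a (s + t) := by
  ext r
  rw [ContinuousMap.mul_apply, kernel_apply ha hs, kernel_apply zero_mem_Icc_zero_one ht,
    kernel_apply ha (by linarith)]
  rcases le_or_gt (r : ℝ) 0 with hr | hr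
  · simp [kernelFun_of_nonpos hr]
  · simp only [kernelFun_of_pos hr, neg_zero, Real.rpow_zero, add_div, neg_add, Real.exp_add]
    ring

/-- The symbol `r ↦ r^a` of `B^{-a}`, `a ≥ 0` (junk value `0` for `a < 0`). -/
def powFun (b a : ℝ) : C(Icc (0 : ℝ) b, ℝ) :=
  if h : 0 ≤ a then
    ⟨fun r => (r : ℝ) ^ a, (Real.continuous_rpow_const h).comp continuous_subtype_val⟩
  else 0

theorem powFun_apply {a : ℝ} (ha : 0 ≤ a) (r : Icc (0 : ℝ) b) : powFun b a r = (r : ℝ) ^ a := by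
  rw [powFun, dif_pos ha]; rfl

theorem powFun_mul_kernel {a t : ℝ} (ha : a ∈ Icc (0 : ℝ) 1) (ht : 0 < t) :
    powFun b a * kernel b a t = kernel b 0 t := by
  ext r
  rw [ContinuousMap.mul_apply, powFun_apply ha.1, kernel_apply ha ht,
    kernel_apply zero_mem_Icc_zero_one ht]
  rcases le_or_gt (r : ℝ) 0 with hr | hr
  · simp [kernelFun_of_nonpos hr]
  · simp only [kernelFun_of_pos hr, neg_zero, Real.rpow_zero]
    rw [← mul_assoc, ← Real.rpow_add hr, add_neg_cancel, Real.rpow_zero]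

theorem powFun_zero : powFun b 0 = 1 := by
  ext r; simp [powFun_apply le_rfl]

theorem powFun_one : powFun b 1 = (ContinuousMap.id ℝ).restrict (Icc 0 b) := by
  ext r; simp [powFun_apply zero_le_one]

theorem powFun_mul_powFun {a c : ℝ} (ha : 0 ≤ a) (hc : 0 ≤ c) :
    powFun b a * powFun b c = powFun b (a + c) := by
  ext r
  rw [ContinuousMap.mul_apply, powFun_apply ha, powFun_apply hc, powFun_apply (by linarith),
    Real.rpow_add_of_nonneg r.2.1 ha hc]

/-- The bound behind the strong continuity of `e^{-tB}` at `t = 0`. -/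
theorem norm_kernel_zero_sub_one_mul_le {t : ℝ} (ht : 0 < t) :
    ‖(kernel b 0 t - 1) * powFun b 1‖ ≤ t := by
  refine (ContinuousMap.norm_le _ ht.le).2 fun r => ?_
  rw [ContinuousMap.mul_apply, ContinuousMap.sub_apply, powFun_apply zero_le_one,
    kernel_apply zero_mem_Icc_zero_one ht, ContinuousMap.one_apply, Real.rpow_one]
  rcases r.2.1.eq_or_lt with hr | hr
  · rw [← hr]; simp [ht.le]
  · have h1 := Real.add_one_le_exp (-(t / (r : ℝ)))
    have h2 : Real.exp (-(t / (r : ℝ))) ≤ 1 := Real.exp_le_one_iff.2 (by simp; positivity)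
    rw [kernelFun_of_pos hr, neg_zero, Real.rpow_zero, one_mul, Real.norm_eq_abs, abs_mul,
      abs_of_pos hr, abs_of_nonpos (by linarith)]
    calc _ ≤ (t / (r : ℝ)) * r := by gcongr; linarith
      _ = t := by field_simp

/-- The bound behind the strong convergence `(e^{-tB} - 1) / t → -B`. -/
theorem norm_kernel_quotient_le {t : ℝ} (ht : 0 < t) :
    ‖((t⁻¹ • ((kernel b 0 t - 1) * powFun b 1) + 1) * powFun b 1 : C(Icc (0 : ℝ) b, ℝ))‖ ≤ t := by
  refine (ContinuousMap.norm_le _ ht.le).2 fun r => ?_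
  rw [ContinuousMap.mul_apply, ContinuousMap.add_apply, ContinuousMap.smul_apply,
    ContinuousMap.mul_apply, ContinuousMap.sub_apply, powFun_apply zero_le_one,
    kernel_apply zero_mem_Icc_zero_one ht, ContinuousMap.one_apply, Real.rpow_one]
  rcases r.2.1.eq_or_lt with hr | hr
  · rw [← hr]; simp [ht.le]
  · rw [kernelFun_of_pos hr, neg_zero, Real.rpow_zero, one_mul]
    set y := t / (r : ℝ) with hy
    have hy0 : 0 < y := by positivity
    have hr' : (r : ℝ) = t / y := by rw [hy]; field_simp
    have h1 := Real.add_one_le_exp (-y)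
    have h2 : Real.exp (-y) ≤ 1 - y + y ^ 2 := by
      have h3 := Real.add_one_le_exp y
      have h4 : Real.exp (-y) ≤ (y + 1)⁻¹ := by
        rw [Real.exp_neg]; gcongr
      refine h4.trans ?_
      rw [inv_le_iff_one_le_mul₀ (by positivity)]
      nlinarith [pow_pos hy0 3]
    rw [hr', smul_eq_mul, Real.norm_eq_abs]
    have h5 : (t⁻¹ * ((Real.exp (-y) - 1) * (t / y)) + 1) * (t / y) =
        t * ((Real.exp (-y) - 1 + y) / y ^ 2) := by field_simp
    rw [h5, abs_mul, abs_of_pos ht, abs_of_nonneg (by apply div_nonneg <;> nlinarith)]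
    have h6 : (Real.exp (-y) - 1 + y) / y ^ 2 ≤ 1 := by
      rw [div_le_one (by positivity)]; linarith
    nlinarith

theorem continuousOn_kernel {a : ℝ} (ha : a ∈ Icc (0 : ℝ) 1) :
    ContinuousOn (kernel b a) (Ioi 0) := by
  intro t ht
  have ht' : 0 < t := ht
  refine ContinuousAt.continuousWithinAt ?_
  rw [Metric.continuousAt_iff]
  intro ε hε
  -- the case `θ = 1` of the Hölder bound, on the half line `(t / 2, ∞)`
  set M := 2 * (t / 2) ^ (-(a + 1)) with hM
  have hM0 : 0 < M := by positivity
  have key : ∀ s s', t / 2 < s → s ≤ s' → dist (kernel b a s') (kernel b a s) ≤ M * (s' - s) := by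
    intro s s' hs hss
    have h := norm_kernel_sub_le (b := b) ha one_mem_Icc_zero_one (by linarith : 0 < s)
      (sub_nonneg.2 hss)
    rw [add_sub_cancel, Real.rpow_one] at h
    rw [dist_eq_norm]
    refine h.trans ?_
    have : s ^ (-(a + 1)) ≤ (t / 2) ^ (-(a + 1)) :=
      Real.rpow_le_rpow_of_nonpos (by positivity) hs.le (by linarith [ha.1])
    have h0 : 0 ≤ s' - s := by linarith
    calc 2 * (s' - s) * s ^ (-(a + 1)) ≤ 2 * (s' - s) * (t / 2) ^ (-(a + 1)) := by gcongr
      _ = _ := by rw [hM]; ring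
  refine ⟨min (t / 2) (ε / M), by positivity, fun s hs => ?_⟩
  rw [Real.dist_eq, lt_min_iff, lt_div_iff₀ hM0] at hs
  have h1 := abs_lt.1 hs.1
  rcases le_total s t with h | h
  · rw [dist_comm]
    refine (key s t (by linarith) h).trans_lt ?_
    rw [abs_of_nonpos (by linarith)] at hs
    linarith [hs.2]
  · refine (key t s (by linarith) h).trans_lt ?_
    rw [abs_of_nonneg (by linarith)] at hs
    linarith [hs.2]

theorem integrableOn_rpow_smul_kernel (hb : 0 < b) {a : ℝ} (ha : 0 < a) :
    IntegrableOn (fun t : ℝ => t ^ (a - 1) • kernel b 0 t) (Ioi 0) := by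
  have h1 : IntegrableOn (fun t : ℝ => t ^ (a - 1) * Real.exp (-((1 / b) * t))) (Ioi 0) := by
    by_contra h
    have h2 := Real.integral_rpow_mul_exp_neg_mul_Ioi ha (by positivity : 0 < 1 / b)
    rw [integral_undef h] at h2
    have := Real.Gamma_pos_of_pos ha
    have : 0 < (1 / (1 / b)) ^ a * Real.Gamma a := by positivity
    linarith
  refine Integrable.mono' h1 ?_ ?_
  · refine ContinuousOn.aestronglyMeasurable ?_ measurableSet_Ioi
    have hc : ContinuousOn (fun t : ℝ => t ^ (a - 1)) (Ioi 0) := fun t ht =>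
      (Real.continuousAt_rpow_const _ _ (.inl (ne_of_gt ht))).continuousWithinAt
    exact hc.smul (continuousOn_kernel zero_mem_Icc_zero_one)
  · refine (ae_restrict_iff' measurableSet_Ioi).2 (.of_forall fun t ht => ?_)
    have ht' : 0 < t := ht
    rw [norm_smul, Real.norm_of_nonneg (by positivity)]
    gcongr
    refine (norm_kernel_zero_le_exp ht').trans (le_of_eq ?_)
    congr 2; ring

/-- Euler's integral `Γ(a)⁻¹ ∫₀^∞ t^{a-1} e^{-t/r} dt = r^a`, in the space of continuous functions
on `[0, b]`. -/
theorem integral_rpow_smul_kernel (hb : 0 < b) {a : ℝ} (ha : 0 < a) :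
    (Real.Gamma a)⁻¹ • ∫ t in Ioi (0 : ℝ), t ^ (a - 1) • kernel b 0 t = powFun b a := by
  ext r
  rw [ContinuousMap.smul_apply, powFun_apply ha.le]
  have h1 := (ContinuousMap.evalCLM (M := ℝ) ℝ r).integral_comp_comm
    (integrableOn_rpow_smul_kernel hb ha)
  simp only [ContinuousMap.evalCLM_apply, ContinuousMap.smul_apply] at h1
  rw [← h1]
  rcases r.2.1.eq_or_lt with hr | hr
  · have : ∫ t in Ioi (0 : ℝ), t ^ (a - 1) • kernel b 0 t r = ∫ t in Ioi (0 : ℝ), (0 : ℝ) := by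
      refine setIntegral_congr_fun measurableSet_Ioi fun t ht => ?_
      simp only [kernel_apply zero_mem_Icc_zero_one (show 0 < t from ht), kernelFun_of_nonpos hr.ge,
        smul_zero]
    rw [this, ← hr, Real.zero_rpow ha.ne']; simp
  · have : ∫ t in Ioi (0 : ℝ), t ^ (a - 1) • kernel b 0 t r =
        ∫ t in Ioi (0 : ℝ), t ^ (a - 1) * Real.exp (-((1 / (r : ℝ)) * t)) := by
      refine setIntegral_congr_fun measurableSet_Ioi fun t ht => ?_
      simp only [kernel_apply zero_mem_Icc_zero_one (show 0 < t from ht), kernelFun_of_pos hr,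
        neg_zero, Real.rpow_zero, one_mul, smul_eq_mul]
      congr 3; ring
    rw [this, Real.integral_rpow_mul_exp_neg_mul_Ioi ha (by positivity), one_div_one_div,
      smul_eq_mul]
    have := (Real.Gamma_pos_of_pos ha).ne'
    field_simp

end Kernel

/-! ### Strongly continuous semigroups and variation of constants -/

section Semigroup

variable {𝕜 X : Type*} [RCLike 𝕜] [NormedAddCommGroup X] [InnerProductSpace 𝕜 X]

theorem IsC0Semigroup.tendsto_apply {S : ℝ → X →L[𝕜] X} (hS : IsC0Semigroup S) {M t : ℝ}
    (hM : ∀ τ ∈ Icc 0 t, ‖S τ‖ ≤ M) {ι : Type*} {l : Filter ι} {τ : ι → ℝ} {ξ : ι → X} {τ₀ : ℝ}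
    {ξ₀ : X} (hτ : Tendsto τ l (𝓝[Icc 0 t] τ₀)) (hτ₀ : τ₀ ∈ Icc 0 t)
    (hξ : Tendsto ξ l (𝓝 ξ₀)) : Tendsto (fun i => S (τ i) (ξ i)) l (𝓝 (S τ₀ ξ₀)) := by
  have h1 : Tendsto (fun i => S (τ i) ξ₀) l (𝓝 (S τ₀ ξ₀)) :=
    ((hS.cont ξ₀ τ₀ hτ₀.1).mono Icc_subset_Ici_self).tendsto.comp hτ
  have h2 : Tendsto (fun i => S (τ i) (ξ i - ξ₀)) l (𝓝 0) := by
    refine squeeze_zero_norm' (a := fun i => M * ‖ξ i - ξ₀‖) ?_ ?_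
    · filter_upwards [hτ.eventually self_mem_nhdsWithin] with i hi
      exact ((S (τ i)).le_opNorm _).trans (by gcongr; exact hM _ hi)
    · have := ((hξ.sub_const ξ₀).norm).const_mul M
      simpa using this
  have := h1.add h2
  simpa using this

theorem IsC0Semigroup.continuousOn_apply {S : ℝ → X →L[𝕜] X} (hS : IsC0Semigroup S) {M t : ℝ}
    (hM : ∀ τ ∈ Icc 0 t, ‖S τ‖ ≤ M) {v : ℝ → X} (hv : ContinuousOn v (Icc 0 t)) :
    ContinuousOn (fun s => S (t - s) (v s)) (Icc 0 t) := fun s hs => by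
  refine hS.tendsto_apply hM ?_ ⟨sub_nonneg.2 hs.2, by linarith [hs.1]⟩ (hv s hs)
  refine tendsto_nhdsWithin_iff.2 ⟨?_, ?_⟩
  · exact ((continuous_const.sub continuous_id).tendsto s).mono_left nhdsWithin_le_nhds
  · filter_upwards [self_mem_nhdsWithin] with r hr
    exact ⟨sub_nonneg.2 hr.2, by linarith [hr.1]⟩

variable [NormedSpace ℝ X] [IsScalarTower ℝ 𝕜 X]

theorem tendsto_sub_nhdsGT (s : ℝ) : Tendsto (fun r => r - s) (𝓝[>] s) (𝓝[>] 0) := by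
  refine tendsto_nhdsWithin_iff.2 ⟨?_, ?_⟩
  · have : Tendsto (fun r => r - s) (𝓝 s) (𝓝 (s - s)) :=
      (continuous_id.sub continuous_const).tendsto s
    rw [sub_self] at this
    exact this.mono_left nhdsWithin_le_nhds
  · filter_upwards [self_mem_nhdsWithin] with r hr using sub_pos.2 (show s < r from hr)

/-- The product rule `d/ds S(t - s) v(s) = S(t - s) (v'(s) - G v(s))`, for right derivatives. -/
theorem IsGenerator.hasDerivWithinAt {G : X →ₗ.[𝕜] X} {S : ℝ → X →L[𝕜] X} (hS : IsC0Semigroup S)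
    (hG : IsGenerator G S) {M t : ℝ} (hM : ∀ τ ∈ Icc 0 t, ‖S τ‖ ≤ M) {v : ℝ → X} {s : ℝ}
    (hs : s ∈ Ico 0 t) {y : X} (hv : HasDerivWithinAt v y (Ioi s) s) (hd : v s ∈ G.domain) :
    HasDerivWithinAt (fun r => S (t - r) (v r)) (S (t - s) (y - G ⟨v s, hd⟩)) (Ioi s) s := by
  rw [hasDerivWithinAt_iff_tendsto_slope' self_notMem_Ioi] at hv ⊢
  have h1 : Tendsto (fun r => (r - s)⁻¹ • (S (r - s) (v s) - v s)) (𝓝[>] s) (𝓝 (G ⟨v s, hd⟩)) :=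
    ((hG _ _).1 ⟨hd, rfl⟩).comp (tendsto_sub_nhdsGT s)
  have hnear : ∀ᶠ r in 𝓝[>] s, r ∈ Ioo s t := Ioo_mem_nhdsGT hs.2
  have hτ : Tendsto (fun r => t - r) (𝓝[>] s) (𝓝[Icc 0 t] (t - s)) := by
    refine tendsto_nhdsWithin_iff.2 ⟨?_, ?_⟩
    · exact ((continuous_const.sub continuous_id).tendsto s).mono_left nhdsWithin_le_nhds
    · filter_upwards [hnear] with r hr
      exact ⟨by linarith [hr.2], by linarith [hr.1, hs.1]⟩
  refine (hS.tendsto_apply hM hτ ⟨by linarith [hs.2], by linarith [hs.1]⟩ (hv.sub h1)).congr' ?_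
  filter_upwards [hnear] with r hr
  have h2 : S (t - s) = (S (t - r)).comp (S (r - s)) := by
    rw [← hS.add _ _ (by linarith [hr.2]) (by linarith [hr.1])]
    congr 1; ring
  rw [slope_def_module, slope_def_module, ← smul_sub, h2, ContinuousLinearMap.comp_apply,
    real_smul_eq (𝕜 := 𝕜), map_smul, ← real_smul_eq (𝕜 := 𝕜), ← map_sub]
  congr 2
  abel

/-- If `S` has generator `-(A + k)`, then `e^{kt} S(t)` has generator `-A`. -/
theorem IsGenerator.exp_smul {A : X →ₗ.[𝕜] X} {k : ℝ} {S : ℝ → X →L[𝕜] X}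
    (hG : IsGenerator (-(shift A k)) S) : IsGenerator (-A) fun t => Real.exp (k * t) • S t := by
  have hexp : Tendsto (fun t : ℝ => Real.exp (k * t)) (𝓝[>] 0) (𝓝 1) := by
    have : Continuous fun t : ℝ => Real.exp (k * t) := by fun_prop
    have h := this.tendsto 0
    simp only [mul_zero, Real.exp_zero] at h
    exact h.mono_left nhdsWithin_le_nhds
  have hquot : Tendsto (fun t : ℝ => t⁻¹ * (Real.exp (k * t) - 1)) (𝓝[>] 0) (𝓝 k) := by
    have h1 : HasDerivAt (fun t : ℝ => Real.exp (k * t)) k 0 := by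
      simpa using ((hasDerivAt_id (0 : ℝ)).const_mul k).exp
    have h2 := (hasDerivWithinAt_iff_tendsto_slope' self_notMem_Ioi).1
      (h1.hasDerivWithinAt (s := Ioi 0))
    refine h2.congr fun t => ?_
    simp [slope_def_field, div_eq_inv_mul]
  have hid : ∀ (x : X) (t : ℝ), t⁻¹ • ((Real.exp (k * t) • S t) x - x) =
      Real.exp (k * t) • (t⁻¹ • (S t x - x)) + (t⁻¹ * (Real.exp (k * t) - 1)) • x := fun x t => by
    rw [_root_.smul_apply]; module
  have hdom : ∀ x : X, x ∈ (-(shift A k)).domain ↔ x ∈ (-A).domain := fun x => Iff.rfl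
  have hval : ∀ x (h : x ∈ (-A).domain) (h' : x ∈ (-(shift A k)).domain),
      (-(shift A k)) ⟨x, h'⟩ + k • x = (-A) ⟨x, h⟩ := fun x h h' => by
    rw [LinearPMap.neg_apply, LinearPMap.neg_apply]
    have : (shift A k) ⟨x, h'⟩ = (k : 𝕜) • x + A ⟨x, h⟩ := rfl
    rw [this, real_smul_eq (𝕜 := 𝕜)]; abel
  intro x y
  constructor
  · rintro ⟨h, rfl⟩
    have h1 := (hG x _).1 ⟨(hdom x).2 h, rfl⟩
    have h2 := (hexp.smul h1).add (hquot.smul_const x)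
    rw [one_smul, hval x h] at h2
    exact h2.congr fun t => (hid x t).symm
  · intro h
    have h1 : Tendsto (fun t : ℝ => t⁻¹ • (S t x - x)) (𝓝[>] 0) (𝓝 (y - k • x)) := by
      have h2 := (hexp.inv₀ one_ne_zero).smul (h.sub (hquot.smul_const x))
      rw [inv_one, one_smul] at h2
      refine h2.congr fun t => ?_
      rw [hid, add_sub_cancel_right, smul_smul, inv_mul_cancel₀ (Real.exp_pos _).ne', one_smul]
    obtain ⟨hd, hv⟩ := (hG x _).2 h1
    refine ⟨(hdom x).1 hd, ?_⟩
    rw [← hval x _ hd, hv]; abel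

theorem IsC0Semigroup.exp_smul {k : ℝ} {S : ℝ → X →L[𝕜] X} (hS : IsC0Semigroup S) :
    IsC0Semigroup fun t => Real.exp (k * t) • S t where
  zero := by simp [hS.zero]
  add s t hs ht := by
    rw [hS.add s t hs ht, mul_add, Real.exp_add]
    ext x
    simp only [_root_.smul_apply, ContinuousLinearMap.comp_apply]
    rw [real_smul_eq (𝕜 := 𝕜) (Real.exp (k * t)), map_smul, ← real_smul_eq (𝕜 := 𝕜), smul_smul]
  cont x := by
    have h : Continuous fun t : ℝ => Real.exp (k * t) := by fun_prop
    exact h.continuousOn.smul (hS.cont x)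

variable [CompleteSpace X]

/-- The variation of constants formula, for a function that satisfies `v' = G v + f` in the sense
of right derivatives. -/
theorem IsGenerator.eq_add_integral {G : X →ₗ.[𝕜] X} {S : ℝ → X →L[𝕜] X} (hS : IsC0Semigroup S)
    (hG : IsGenerator G S) {M t : ℝ} (ht : 0 ≤ t) (hM : ∀ τ ∈ Icc 0 t, ‖S τ‖ ≤ M) {v f : ℝ → X}
    (hv : ContinuousOn v (Icc 0 t)) (hf : ContinuousOn f (Icc 0 t))
    (h : ∀ s ∈ Ioo 0 t, ∃ hd : v s ∈ G.domain,
      HasDerivWithinAt v (G ⟨v s, hd⟩ + f s) (Ioi s) s) :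
    v t = S t (v 0) + ∫ s in (0 : ℝ)..t, S (t - s) (f s) := by
  have h1 := intervalIntegral.integral_eq_sub_of_hasDeriv_right (a := 0) (b := t)
    (f := fun s => S (t - s) (v s)) (f' := fun s => S (t - s) (f s))
    (by rw [uIcc_of_le ht]; exact hS.continuousOn_apply hM hv)
    (fun s hs => by
      rw [min_eq_left ht, max_eq_right ht] at hs
      obtain ⟨hd, hder⟩ := h s hs
      have := hG.hasDerivWithinAt hS hM ⟨hs.1.le, hs.2⟩ hder hd
      rwa [add_sub_cancel_left] at this)
    (by
      refine ContinuousOn.intervalIntegrable ?_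
      rw [uIcc_of_le ht]; exact hS.continuousOn_apply hM hf)
  rw [h1, sub_self, sub_zero, hS.zero]
  simp

/-- A strongly continuous semigroup is determined by its generator. -/
theorem IsGenerator.semigroup_unique {G : X →ₗ.[𝕜] X} (hdense : Dense (G.domain : Set X))
    {S S' : ℝ → X →L[𝕜] X} (hS : IsC0Semigroup S) (hG : IsGenerator G S)
    (hS' : IsC0Semigroup S') (hG' : IsGenerator G S') {M t : ℝ} (ht : 0 ≤ t)
    (hM : ∀ τ ∈ Icc 0 t, ‖S τ‖ ≤ M) : S' t = S t := by
  refine ContinuousLinearMap.ext fun x => ?_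
  refine congrFun (Continuous.ext_on hdense (S' t).continuous (S t).continuous fun x hx => ?_) x
  have key : ∀ s, 0 ≤ s → ∀ h : ℝ, 0 ≤ h →
      h⁻¹ • (S' h (S' s x) - S' s x) = S' s (h⁻¹ • (S' h x - x)) := fun s hs h hh => by
    have : S' h (S' s x) = S' s (S' h x) := by
      rw [← ContinuousLinearMap.comp_apply, ← ContinuousLinearMap.comp_apply,
        ← hS'.add _ _ hh hs, ← hS'.add _ _ hs hh, add_comm]
    rw [this, real_smul_eq (𝕜 := 𝕜), real_smul_eq (𝕜 := 𝕜), map_smul, map_sub]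
  have hlim : ∀ s, 0 ≤ s → Tendsto (fun h : ℝ => h⁻¹ • (S' h (S' s x) - S' s x)) (𝓝[>] 0)
      (𝓝 (S' s (G ⟨x, hx⟩))) := fun s hs => by
    refine (((S' s).continuous.tendsto _).comp ((hG' _ _).1 ⟨hx, rfl⟩)).congr' ?_
    filter_upwards [self_mem_nhdsWithin] with h hh
    exact (key s hs h (le_of_lt hh)).symm
  have h := hG.eq_add_integral hS ht hM (v := fun s => S' s x) (f := fun _ => 0)
    ((hS'.cont x).mono Icc_subset_Ici_self) continuousOn_const (fun s hs => by
      obtain ⟨hd, hval⟩ := (hG' _ _).2 (hlim s hs.1.le)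
      refine ⟨hd, ?_⟩
      rw [add_zero, hval, hasDerivWithinAt_iff_tendsto_slope' self_notMem_Ioi]
      refine ((hlim s hs.1.le).comp (tendsto_sub_nhdsGT s)).congr' ?_
      filter_upwards [self_mem_nhdsWithin] with r hr
      have hr' : s < r := hr
      rw [slope_def_module, Function.comp_apply, ← ContinuousLinearMap.comp_apply,
        ← hS'.add _ _ (by linarith) hs.1.le, sub_add_cancel])
  simpa [hS'.zero] using h

/-- The semigroup `e^{-At}` is any bounded family that is a strongly continuous semigroup with
generator `-A`. -/
theorem semigroup_eq {A : X →ₗ.[𝕜] X} (hdense : Dense (A.domain : Set X)) {S : ℝ → X →L[𝕜] X}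
    (hS : IsC0Semigroup S) (hG : IsGenerator (-A) S) {M t : ℝ} (ht : 0 ≤ t)
    (hM : ∀ τ ∈ Icc 0 t, ‖S τ‖ ≤ M) : semigroup A t = S t := by
  have hex : ∃ S : ℝ → X →L[𝕜] X, IsC0Semigroup S ∧ IsGenerator (-A) S := ⟨S, hS, hG⟩
  rw [semigroup, dif_pos hex]
  exact IsGenerator.semigroup_unique (G := -A) hdense hS hG hex.choose_spec.1 hex.choose_spec.2
    ht hM

end Semigroup

/-! ### The semigroup and its smoothing kernels as functions of `B⁻¹` -/

section Calculus

variable {𝕜 X : Type*} [RCLike 𝕜] [NormedAddCommGroup X] [InnerProductSpace 𝕜 X]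

theorem tendsto_zero_of_denseRange {ι : Type*} {l : Filter ι} {F : ι → X →L[𝕜] X} {M : ℝ}
    (hM : ∀ᶠ i in l, ‖F i‖ ≤ M) {R : X →L[𝕜] X} (hd : DenseRange R)
    (h : ∀ y, Tendsto (fun i => F i (R y)) l (𝓝 0)) (x : X) :
    Tendsto (fun i => F i x) l (𝓝 0) := by
  rw [Metric.tendsto_nhds]
  intro ε hε
  set M' := |M| + 1
  have hM' : 0 < M' := by positivity
  obtain ⟨y, hy⟩ := hd.exists_dist_lt x (show 0 < ε / 2 / M' by positivity)
  filter_upwards [hM, Metric.tendsto_nhds.1 (h y) (ε / 2) (by positivity)] with i hi hi'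
  rw [dist_zero_right] at hi' ⊢
  have h1 : F i x = F i (x - R y) + F i (R y) := by rw [map_sub]; abel
  have h2 : ‖F i (x - R y)‖ ≤ ε / 2 := by
    rw [dist_eq_norm] at hy
    calc _ ≤ ‖F i‖ * ‖x - R y‖ := (F i).le_opNorm _
      _ ≤ M' * (ε / 2 / M') := by
          gcongr
          exact hi.trans ((le_abs_self M).trans (by simp [M']))
      _ = _ := by field_simp
  rw [h1]
  exact (norm_add_le _ _).trans_lt (by linarith)

variable [NormedSpace ℝ X] [IsScalarTower ℝ 𝕜 X]

/-- `φ` is the continuous functional calculus, on `[0, b]`, of the operator `R`. -/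
structure IsCalculus (b : ℝ) (R : X →L[𝕜] X) (φ : C(Icc (0 : ℝ) b, ℝ) →L[ℝ] (X →L[𝕜] X)) :
    Prop where
  norm_le : ∀ f, ‖φ f‖ ≤ ‖f‖
  map_mul : ∀ f g, φ (f * g) = φ f * φ g
  map_one : φ 1 = 1
  map_id : φ (powFun b 1) = R

/-- The semigroup `e^{-tB}` as a function of `R = B⁻¹`. -/
def expOp {b : ℝ} (φ : C(Icc (0 : ℝ) b, ℝ) →L[ℝ] (X →L[𝕜] X)) (t : ℝ) : X →L[𝕜] X :=
  if t ≤ 0 then 1 else φ (kernel b 0 t)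

theorem expOp_of_pos {b : ℝ} {φ : C(Icc (0 : ℝ) b, ℝ) →L[ℝ] (X →L[𝕜] X)} {t : ℝ} (ht : 0 < t) :
    expOp φ t = φ (kernel b 0 t) := if_neg ht.not_ge

theorem expOp_zero {b : ℝ} {φ : C(Icc (0 : ℝ) b, ℝ) →L[ℝ] (X →L[𝕜] X)} :
    expOp φ 0 = 1 := if_pos le_rfl

namespace IsCalculus

variable {b : ℝ} {R : X →L[𝕜] X} {φ : C(Icc (0 : ℝ) b, ℝ) →L[ℝ] (X →L[𝕜] X)}

theorem comm (hφ : IsCalculus b R φ) (f g) : φ f * φ g = φ g * φ f := by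
  rw [← hφ.map_mul, ← hφ.map_mul, mul_comm]

theorem norm_expOp_le (hφ : IsCalculus b R φ) (hb : 0 < b) (t : ℝ) : ‖expOp φ t‖ ≤ 1 := by
  rcases le_or_gt t 0 with ht | ht
  · rw [expOp, if_pos ht]; exact ContinuousLinearMap.norm_id_le
  · rw [expOp_of_pos ht]
    refine (hφ.norm_le _).trans ((norm_kernel_zero_le_exp ht).trans ?_)
    exact Real.exp_le_one_iff.2 (by simp; positivity)

theorem commute_expOp (hφ : IsCalculus b R φ) (f) (t : ℝ) : φ f * expOp φ t = expOp φ t * φ f := by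
  unfold expOp
  split_ifs
  · rw [mul_one, one_mul]
  · exact hφ.comm _ _

theorem isC0Semigroup (hφ : IsCalculus b R φ) (hb : 0 < b) (hd : DenseRange R) :
    IsC0Semigroup (expOp φ) where
  zero := expOp_zero
  add s t hs ht := by
    rcases hs.eq_or_lt with rfl | hs
    · rw [zero_add, expOp_zero]; rfl
    rcases ht.eq_or_lt with rfl | ht
    · rw [add_zero, expOp_zero]; rfl
    rw [expOp_of_pos hs, expOp_of_pos ht, expOp_of_pos (by linarith),
      ← kernel_mul_kernel zero_mem_Icc_zero_one hs ht, hφ.map_mul]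
    rfl
  cont x := by
    intro t ht
    rcases (show 0 ≤ t from ht).eq_or_lt with rfl | ht
    · refine continuousWithinAt_Ioi_iff_Ici.1 ?_
      have h : Tendsto (fun t => (expOp φ t - 1) x) (𝓝[>] 0) (𝓝 0) := by
        refine tendsto_zero_of_denseRange (M := 2) (.of_forall fun t => ?_) hd (fun y => ?_) x
        · refine (norm_sub_le _ _).trans ?_
          have h1 : ‖(1 : X →L[𝕜] X)‖ ≤ 1 := ContinuousLinearMap.norm_id_le
          linarith [hφ.norm_expOp_le hb t]
        · have h0 : Tendsto (fun t : ℝ => t * ‖y‖) (𝓝[>] 0) (𝓝 0) := by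
            have : Continuous fun t : ℝ => t * ‖y‖ := by fun_prop
            simpa using (this.tendsto 0).mono_left nhdsWithin_le_nhds
          refine squeeze_zero_norm' ?_ h0
          filter_upwards [self_mem_nhdsWithin] with t ht
          have ht' : 0 < t := ht
          have h1 : (expOp φ t - 1) (R y) = φ ((kernel b 0 t - 1) * powFun b 1) y := by
            rw [hφ.map_mul, map_sub, hφ.map_one, hφ.map_id, expOp_of_pos ht']; rfl
          rw [h1]
          exact ((φ _).le_opNorm y).trans (by
            gcongr; exact (hφ.norm_le _).trans (norm_kernel_zero_sub_one_mul_le ht'))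
      have h2 := h.add_const x
      rw [zero_add] at h2
      have h3 : expOp φ 0 x = x := by rw [expOp_zero]; rfl
      rw [ContinuousWithinAt, h3]
      refine h2.congr fun t => ?_
      simp
    · have h1 : ContinuousAt (kernel b 0) t :=
        (continuousOn_kernel zero_mem_Icc_zero_one).continuousAt (Ioi_mem_nhds ht)
      have h2 : ContinuousAt (fun s => φ (kernel b 0 s) x) t :=
        (φ.continuous.continuousAt.comp h1).clm_apply continuousAt_const
      refine (h2.congr ?_).continuousWithinAt
      filter_upwards [Ioi_mem_nhds ht] with s hs
      rw [expOp_of_pos hs]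

theorem isGenerator (hφ : IsCalculus b R φ) (hd : DenseRange R) {B : X →ₗ.[𝕜] X}
    (h₁ : ∀ x : X, ∃ h : R x ∈ B.domain, B ⟨R x, h⟩ = x)
    (h₂ : ∀ x : B.domain, R (B x) = x) : IsGenerator (-B) (expOp φ) := by
  set N : ℝ → X →L[𝕜] X := fun t => φ (t⁻¹ • ((kernel b 0 t - 1) * powFun b 1)) with hN
  have hNeq : ∀ t, 0 < t → N t = t⁻¹ • ((expOp φ t - 1) * R) := fun t ht => by
    rw [hN]; simp only
    rw [map_smul, hφ.map_mul, map_sub, hφ.map_one, hφ.map_id, expOp_of_pos ht]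
  have hlim : ∀ x, Tendsto (fun t => N t x) (𝓝[>] 0) (𝓝 (-x)) := fun x => by
    have h : Tendsto (fun t => (N t + 1) x) (𝓝[>] 0) (𝓝 0) := by
      refine tendsto_zero_of_denseRange (M := 2) ?_ hd (fun y => ?_) x
      · filter_upwards [self_mem_nhdsWithin] with t ht
        have ht' : 0 < t := ht
        have h1 : ‖N t‖ ≤ 1 := by
          refine (hφ.norm_le _).trans ?_
          rw [norm_smul, Real.norm_of_nonneg (by positivity), inv_mul_le_iff₀ ht', mul_one]
          exact norm_kernel_zero_sub_one_mul_le ht'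
        refine (norm_add_le _ _).trans ?_
        have h2 : ‖(1 : X →L[𝕜] X)‖ ≤ 1 := ContinuousLinearMap.norm_id_le
        linarith
      · have h0 : Tendsto (fun t : ℝ => t * ‖y‖) (𝓝[>] 0) (𝓝 0) := by
          have : Continuous fun t : ℝ => t * ‖y‖ := by fun_prop
          simpa using (this.tendsto 0).mono_left nhdsWithin_le_nhds
        refine squeeze_zero_norm' ?_ h0
        filter_upwards [self_mem_nhdsWithin] with t ht
        have ht' : 0 < t := ht
        have h1 : (N t + 1) (R y) =
            φ ((t⁻¹ • ((kernel b 0 t - 1) * powFun b 1) + 1) * powFun b 1) y := by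
          rw [hφ.map_mul, map_add, hφ.map_one, hφ.map_id]; rfl
        rw [h1]
        exact ((φ _).le_opNorm y).trans (by
          gcongr; exact (hφ.norm_le _).trans (norm_kernel_quotient_le ht'))
    have h2 := h.sub_const x
    rw [zero_sub] at h2
    refine h2.congr fun t => ?_
    simp
  intro x y
  constructor
  · rintro ⟨h, rfl⟩
    have h3 : x ∈ B.domain := h
    rw [LinearPMap.neg_apply]
    refine (hlim (B ⟨x, h3⟩)).congr' ?_
    filter_upwards [self_mem_nhdsWithin] with t ht
    rw [hNeq t ht, _root_.smul_apply, mul_apply_eq_comp, h₂ ⟨x, h3⟩]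
    simp
  · intro h
    have h3 := (R.continuous.tendsto _).comp h
    have h4 : R y = -x := by
      refine tendsto_nhds_unique (h3.congr' ?_) (hlim x)
      filter_upwards [self_mem_nhdsWithin] with t ht
      have h5 : (expOp φ t - 1) * R = R * (expOp φ t - 1) := by
        rw [mul_sub, sub_mul, mul_one, one_mul, ← hφ.map_id, hφ.commute_expOp]
      rw [hNeq t ht, h5, _root_.smul_apply, mul_apply_eq_comp, Function.comp_apply,
        real_smul_eq (𝕜 := 𝕜), real_smul_eq (𝕜 := 𝕜), map_smul]
      simp
    have h6 : R (-y) = x := by rw [map_neg, h4, neg_neg]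
    obtain ⟨hd', hv⟩ := h₁ (-y)
    have hx : x ∈ B.domain := h6 ▸ hd'
    refine ⟨hx, ?_⟩
    rw [LinearPMap.neg_apply]
    have : B ⟨x, hx⟩ = -y := by
      rw [← hv]; congr 1; exact Subtype.ext h6.symm
    rw [this, neg_neg]

variable [CompleteSpace X]

/-- The fractional power `B^{-a}` is the operator with symbol `r^a`. -/
theorem negPow_eq (hφ : IsCalculus b R φ) (hb : 0 < b) {B : X →ₗ.[𝕜] X}
    (hB : ∀ t, 0 ≤ t → semigroup B t = expOp φ t) {a : ℝ} (ha : 0 ≤ a) (u : X) :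
    negPow B a u = φ (powFun b a) u := by
  unfold negPow
  split_ifs with h
  · rw [h, powFun_zero, hφ.map_one]; rfl
  · have ha' : 0 < a := lt_of_le_of_ne ha (Ne.symm h)
    have hint := integrableOn_rpow_smul_kernel (b := b) hb ha'
    have h1 : ∫ t in Ioi (0 : ℝ), t ^ (a - 1) • semigroup B t u =
        ∫ t in Ioi (0 : ℝ), (φ (t ^ (a - 1) • kernel b 0 t)) u := by
      refine setIntegral_congr_fun measurableSet_Ioi fun t ht => ?_
      have ht' : 0 < t := ht
      simp only [hB t ht'.le, expOp_of_pos ht', map_smul, _root_.smul_apply]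
    rw [h1, ← ContinuousLinearMap.integral_apply (φ.integrable_comp hint),
      φ.integral_comp_comm hint, ← integral_rpow_smul_kernel hb ha', map_smul, _root_.smul_apply]

end IsCalculus

/-- The family `P(t)`, `0 < t ≤ 1`, is of the type of `B^a S(t)` where `S` is an analytic semigroup
and `J = B^{-a}`: `J P(t) = S(t)`, with the bound and the Hölder bounds that go with it. -/
structure IsPowerKernel (S : ℝ → X →L[𝕜] X) (C a : ℝ) (J : X →L[𝕜] X) (P : ℝ → X →L[𝕜] X) :
    Prop where
  factor : ∀ t ∈ Ioc (0 : ℝ) 1, J * P t = S t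
  cont : ContinuousOn P (Ioc 0 1)
  bound : ∀ t ∈ Ioc (0 : ℝ) 1, ‖P t‖ ≤ C * t ^ (-a)
  holder : ∀ θ ∈ Icc (0 : ℝ) 1, ∀ t h, 0 < t → 0 ≤ h → t + h ≤ 1 →
    ‖P (t + h) - P t‖ ≤ C * h ^ θ * t ^ (-(a + θ))

theorem exp_mul_sub_one_le {k h θ : ℝ} (hk : 0 ≤ k) (hh : h ∈ Icc (0 : ℝ) 1)
    (hθ : θ ∈ Icc (0 : ℝ) 1) : |Real.exp (k * h) - 1| ≤ k * Real.exp k * h ^ θ := by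
  have h1 : 0 ≤ k * h := mul_nonneg hk hh.1
  have h2 := Real.add_one_le_exp (-(k * h))
  have h3 : h ≤ h ^ θ := by
    rcases hh.1.eq_or_lt with rfl | h0
    · exact Real.rpow_nonneg le_rfl θ
    · simpa using Real.rpow_le_rpow_of_exponent_ge h0 hh.2 hθ.2
  rw [abs_of_nonneg (by linarith [Real.one_le_exp h1])]
  calc Real.exp (k * h) - 1 = Real.exp (k * h) * (1 - Real.exp (-(k * h))) := by
        rw [mul_sub, ← Real.exp_add, add_neg_cancel, Real.exp_zero, mul_one]
    _ ≤ Real.exp k * (k * h) := by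
        gcongr
        · exact sub_nonneg.2 (Real.exp_le_one_iff.2 (by linarith))
        · exact mul_le_of_le_one_right hk hh.2
        · linarith
    _ ≤ Real.exp k * (k * h ^ θ) := by gcongr
    _ = _ := by ring

/-- The constant in the bounds for `e^{kt} B^a e^{-tB}`. -/
def kernelConst (k : ℝ) : ℝ := Real.exp k * (2 + 2 * (k * Real.exp k))

theorem IsCalculus.isPowerKernel {b : ℝ} {R : X →L[𝕜] X}
    {φ : C(Icc (0 : ℝ) b, ℝ) →L[ℝ] (X →L[𝕜] X)} (hφ : IsCalculus b R φ) {k : ℝ} (hk : 0 ≤ k)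
    {a : ℝ} (ha : a ∈ Icc (0 : ℝ) 1) :
    IsPowerKernel (fun t => Real.exp (k * t) • expOp φ t) (kernelConst k) a (φ (powFun b a))
      fun t => Real.exp (k * t) • φ (kernel b a t) where
  factor t ht := by
    rw [mul_smul_comm, ← hφ.map_mul, powFun_mul_kernel ha ht.1, expOp_of_pos ht.1]
  cont := by
    have h1 : Continuous fun t : ℝ => Real.exp (k * t) := by fun_prop
    refine h1.continuousOn.smul (φ.continuous.comp_continuousOn ?_)
    exact (continuousOn_kernel ha).mono fun t ht => ht.1
  bound t ht := by
    have ht0 := ht.1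
    rw [norm_smul, Real.norm_of_nonneg (Real.exp_pos _).le]
    calc _ ≤ Real.exp k * (2 * t ^ (-a)) := by
          gcongr
          · exact mul_le_of_le_one_right hk ht.2
          · exact (hφ.norm_le _).trans (norm_kernel_le ha ht.1)
      _ ≤ kernelConst k * t ^ (-a) := by
          rw [kernelConst, ← mul_assoc]; gcongr
          have : 0 ≤ 2 * (k * Real.exp k) := by positivity
          linarith
  holder θ hθ t h ht hh hth := by
    have h1 : Real.exp (k * (t + h)) • φ (kernel b a (t + h)) - Real.exp (k * t) • φ (kernel b a t)
        = Real.exp (k * t) • ((Real.exp (k * h) - 1) • φ (kernel b a (t + h)) +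
          φ (kernel b a (t + h) - kernel b a t)) := by
      rw [mul_add, Real.exp_add, map_sub]; module
    rw [h1, norm_smul, Real.norm_of_nonneg (Real.exp_pos _).le]
    have h2 : ‖(Real.exp (k * h) - 1) • φ (kernel b a (t + h))‖ ≤
        k * Real.exp k * h ^ θ * (2 * t ^ (-(a + θ))) := by
      rw [norm_smul, Real.norm_eq_abs]
      have h3 : ‖φ (kernel b a (t + h))‖ ≤ 2 * t ^ (-(a + θ)) := by
        refine (hφ.norm_le _).trans ((norm_kernel_le ha (by linarith)).trans ?_)
        gcongr 2 * ?_
        refine (Real.rpow_le_rpow_of_nonpos ht (by linarith) (by linarith [ha.1])).trans ?_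
        exact Real.rpow_le_rpow_of_exponent_ge ht (by linarith) (by linarith [hθ.1])
      have := exp_mul_sub_one_le hk ⟨hh, by linarith⟩ hθ
      gcongr
    have h4 := (hφ.norm_le _).trans (norm_kernel_sub_le (b := b) ha hθ ht hh)
    calc _ ≤ Real.exp k * (k * Real.exp k * h ^ θ * (2 * t ^ (-(a + θ))) +
          2 * h ^ θ * t ^ (-(a + θ))) := by
          gcongr
          · exact mul_le_of_le_one_right hk (by linarith)
          · exact (norm_add_le _ _).trans (add_le_add h2 h4)
      _ = _ := by rw [kernelConst]; ring

end Calculus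

/-! ### The linear problem for a self-adjoint operator -/

section SelfAdjoint

variable {𝕜 X : Type*} [RCLike 𝕜] [NormedAddCommGroup X] [InnerProductSpace 𝕜 X]

theorem inner_shift [CompleteSpace X] {A : X →ₗ.[𝕜] X} (hA : IsSelfAdjoint A) (k : ℝ)
    (x y : (shift A k).domain) :
    inner 𝕜 (shift A k x) (y : X) = inner 𝕜 (x : X) (shift A k y) := by
  have h := LinearPMap.adjoint_isFormalAdjoint hA.dense_domain
  rw [LinearPMap.isSelfAdjoint_def.1 hA] at h
  have hv : ∀ z : (shift A k).domain, shift A k z = (k : 𝕜) • (z : X) + A ⟨z, z.2⟩ := fun z => rfl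
  rw [hv, hv, inner_add_left, inner_add_right, inner_smul_left, inner_smul_right,
    RCLike.conj_ofReal, h ⟨x, x.2⟩ ⟨y, y.2⟩]

variable [NormedSpace ℝ X] [IsScalarTower ℝ 𝕜 X]

/-- If `R` is the inverse of `B` and the real number `m⁻¹ ≠ 0` belongs to the resolvent set of `B`,
then `m` belongs to the resolvent set of `R`. -/
theorem isUnit_sub_of_mem_resolventSet {B : X →ₗ.[𝕜] X} {R : X →L[𝕜] X}
    (h₁ : ∀ x : X, ∃ h : R x ∈ B.domain, B ⟨R x, h⟩ = x) (h₂ : ∀ x : B.domain, R (B x) = x)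
    {m : ℝ} (hm : m ≠ 0) (hres : ((m⁻¹ : ℝ) : 𝕜) ∈ resolventSet B) :
    IsUnit (R - algebraMap ℝ (X →L[𝕜] X) m) := by
  obtain ⟨R', h₁', h₂'⟩ := hres
  set c : 𝕜 := ((m⁻¹ : ℝ) : 𝕜) with hc
  have hcm : c * (m : 𝕜) = 1 := by
    rw [hc, ← RCLike.ofReal_mul, inv_mul_cancel₀ hm, RCLike.ofReal_one]
  rw [isUnit_iff_exists]
  refine ⟨(-c) • (1 + c • R'), ContinuousLinearMap.ext fun y => ?_,
    ContinuousLinearMap.ext fun y => ?_⟩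
  · obtain ⟨hd, hv⟩ := h₁' y
    have h3 : R' y = R y + c • R (R' y) := by
      have h4 := h₂ ⟨R' y, hd⟩
      rw [sub_eq_iff_eq_add.1 hv, map_add, map_smul] at h4
      exact h4.symm
    simp only [mul_apply_eq_comp, _root_.sub_apply, _root_.smul_apply, _root_.add_apply,
      one_apply_eq_self, algebraMap_clm_apply, map_smul, map_add]
    linear_combination (norm := module) c • h3 + hcm • (c • R' y + y)
  · obtain ⟨hd, hv⟩ := h₁ y
    have h3 : R' y - c • R' (R y) = R y := by
      have h4 := h₂' ⟨R y, hd⟩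
      rwa [hv, map_sub, map_smul] at h4
    simp only [mul_apply_eq_comp, _root_.sub_apply, _root_.smul_apply, _root_.add_apply,
      one_apply_eq_self, algebraMap_clm_apply, map_smul, map_sub]
    linear_combination (norm := module) c • h3 + hcm • (c • R' y + y)

variable [CompleteSpace X]

/-- What the proof uses about the linear problem: `S(t) = e^{-At}` (for `t ≥ 0`),
`R = B⁻¹`, `J = B^{-α}`, `P(t) = B^α S(t)`, `D(t) = B S(t)` and `Q = B ∫₀¹ S(s) ds`, where
`B = A + k`. All bounds on the time interval `(0, 1]` hold with the constant `C`. -/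
structure IsParabolic (A : X →ₗ.[𝕜] X) (k α C : ℝ) (S P D : ℝ → X →L[𝕜] X)
    (J R Q : X →L[𝕜] X) : Prop where
  one_le : 1 ≤ C
  isC0Semigroup : IsC0Semigroup S
  isGenerator : IsGenerator (-A) S
  norm_le : ∀ t ∈ Icc (0 : ℝ) 1, ‖S t‖ ≤ C
  bounded : ∀ t, 0 ≤ t → ∃ M, ∀ τ ∈ Icc 0 t, ‖S τ‖ ≤ M
  semigroup_eq : ∀ t, 0 ≤ t → semigroup A t = S t
  kernel_zero : IsPowerKernel S C 0 1 S
  kernel_frac : IsPowerKernel S C α J P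
  kernel_one : IsPowerKernel S C 1 R D
  comm : ∀ t, 0 ≤ t → ∀ x, J (S t x) = S t (J x)
  J_inj : Function.Injective J
  R_inj : Function.Injective R
  negPow_frac : ∀ u, negPow (shift A k) α u = J u
  negPow_one : ∀ u, negPow (shift A k) 1 u = R u
  range_R : Set.range R = (A.domain : Set X)
  integral_eq : ∀ x, ∫ s in (0 : ℝ)..1, S s x = R (Q x)

theorem one_le_kernelConst {k : ℝ} (hk : 0 ≤ k) : 1 ≤ kernelConst k := by
  have h1 := Real.one_le_exp hk
  have h2 : 0 ≤ 2 * (k * Real.exp k) := by positivity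
  rw [kernelConst]
  nlinarith

/-- The range of `∫₀¹ S(s) ds` is contained in the domain of the generator. -/
theorem exists_integral_eq {A : X →ₗ.[𝕜] X} {k C : ℝ} {S : ℝ → X →L[𝕜] X} {R : X →L[𝕜] X}
    (h₁ : ∀ x : X, ∃ h : R x ∈ (shift A k).domain, shift A k ⟨R x, h⟩ = x)
    (hcomm : ∀ t x, R (S t x) = S t (R x))
    (hS : IsC0Semigroup S) (hG : IsGenerator (-A) S) (hM : ∀ t ∈ Icc (0 : ℝ) 1, ‖S t‖ ≤ C)
    (hcont : ContinuousOn S (Ioc 0 1)) :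
    ∃ Q : X →L[𝕜] X, ∀ x, ∫ s in (0 : ℝ)..1, S s x = R (Q x) := by
  have hint : IntervalIntegrable S volume 0 1 := by
    rw [intervalIntegrable_iff_integrableOn_Ioc_of_le zero_le_one]
    refine Integrable.of_bound (hcont.aestronglyMeasurable measurableSet_Ioc) C ?_
    refine (ae_restrict_iff' measurableSet_Ioc).2 (.of_forall fun t ht => hM t ⟨ht.1.le, ht.2⟩)
  have happ : ∀ x, (∫ s in (0 : ℝ)..1, S s) x = ∫ s in (0 : ℝ)..1, S s x := fun x =>
    ContinuousLinearMap.intervalIntegral_apply hint x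
  have hintx : ∀ x, IntervalIntegrable (fun s => S s x) volume 0 1 := fun x => by
    refine ContinuousOn.intervalIntegrable ?_
    rw [uIcc_of_le zero_le_one]
    exact (hS.cont x).mono Icc_subset_Ici_self
  refine ⟨1 - S 1 + (k : 𝕜) • ∫ s in (0 : ℝ)..1, S s, fun x => ?_⟩
  obtain ⟨hd, hv⟩ := h₁ x
  have hd' : R x ∈ (-A).domain := hd
  have hv' : (-A) ⟨R x, hd'⟩ = (k : 𝕜) • R x - x := by
    have : shift A k ⟨R x, hd⟩ = (k : 𝕜) • R x + A ⟨R x, hd⟩ := rfl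
    rw [this] at hv
    rw [LinearPMap.neg_apply, ← sub_eq_iff_eq_add'.2 hv.symm]; abel
  -- the variation of constants formula for the constant function `s ↦ R x`
  have h2 := hG.eq_add_integral hS zero_le_one hM (v := fun _ => R x)
    (f := fun _ => x - (k : 𝕜) • R x) continuousOn_const continuousOn_const (fun s _ =>
      ⟨hd', by
        rw [hv', sub_add_sub_cancel, sub_self]; exact hasDerivWithinAt_const _ _ _⟩)
  rw [intervalIntegral.integral_comp_sub_left (fun s => S s (x - (k : 𝕜) • R x)), sub_self,
    sub_zero] at h2
  simp only [map_sub, map_smul] at h2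
  rw [intervalIntegral.integral_sub (hintx x)] at h2
  · have h3 : ∫ s in (0 : ℝ)..1, (k : 𝕜) • S s (R x) =
        (k : 𝕜) • R ((∫ s in (0 : ℝ)..1, S s) x) := by
      rw [intervalIntegral.integral_smul, happ x, ← R.intervalIntegral_comp_comm (hintx x)]
      simp only [hcomm]
    rw [h3] at h2
    simp only [_root_.add_apply, _root_.sub_apply, _root_.smul_apply, one_apply_eq_self, map_add,
      map_sub, map_smul, hcomm]
    linear_combination (norm := module) -h2
  · have := (hintx (R x)).smul (k : 𝕜)
    exact this

theorem exists_isParabolic {A : X →ₗ.[𝕜] X} (hA : IsSelfAdjoint A) {k : ℝ} (hk : 0 ≤ k)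
    (hspec : ∀ z ∈ spectrum (shift A k), 0 < RCLike.re z) {α : ℝ} (hα : α ∈ Ico (0 : ℝ) 1) :
    ∃ C S P D J R Q, IsParabolic A k α C S P D J R Q := by
  have hres : ∀ m : ℝ, m ≤ 0 → (m : 𝕜) ∈ resolventSet (shift A k) := fun m hm => by
    by_contra h
    have := hspec _ h
    rw [RCLike.ofReal_re] at this
    linarith
  obtain ⟨R, h₁, h₂⟩ := hres 0 le_rfl
  simp only [RCLike.ofReal_zero, zero_smul, sub_zero] at h₁ h₂
  have hsym : ∀ x y, inner 𝕜 (R x) y = inner 𝕜 x (R y) := fun x y => by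
    obtain ⟨hx, hvx⟩ := h₁ x
    obtain ⟨hy, hvy⟩ := h₁ y
    have := inner_shift hA k ⟨R x, hx⟩ ⟨R y, hy⟩
    rw [hvx, hvy] at this
    exact this.symm
  have hpos := re_inner_nonneg_of_isUnit hsym fun m hm =>
    isUnit_sub_of_mem_resolventSet h₁ h₂ hm.ne (hres _ (inv_nonpos.2 hm.le))
  set b := ‖R‖ + 1
  have hb : 0 < b := by positivity
  obtain ⟨φ, hφ1, hφ2, hφ3, hφ4⟩ := exists_functionalCalculus hsym hpos (b := b)
    (by simp [b])
  rw [← powFun_one] at hφ4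
  have hφ : IsCalculus b R φ := ⟨hφ1, hφ2, hφ3, hφ4⟩
  have hrange : Set.range R = (A.domain : Set X) := by
    ext x
    constructor
    · rintro ⟨y, rfl⟩
      exact (h₁ y).1
    · intro hx
      exact ⟨_, h₂ ⟨x, hx⟩⟩
  have hd : DenseRange R := by rw [DenseRange, hrange]; exact hA.dense_domain
  have hRinj : Function.Injective R := by
    intro x y hxy
    obtain ⟨hx, hvx⟩ := h₁ x
    obtain ⟨hy, hvy⟩ := h₁ y
    rw [← hvx, ← hvy]; congr 1; exact Subtype.ext hxy
  have hc0 := hφ.isC0Semigroup hb hd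
  have hgen := hφ.isGenerator hd h₁ h₂
  have hSB : ∀ t, 0 ≤ t → semigroup (shift A k) t = expOp φ t := fun t ht =>
    Parabolic.semigroup_eq (A := shift A k) hA.dense_domain hc0 hgen ht
      (fun τ _ => hφ.norm_expOp_le hb τ)
  have hbd : ∀ t, ∀ τ ∈ Icc 0 t, ‖Real.exp (k * τ) • expOp φ τ‖ ≤ Real.exp (k * t) :=
    fun t τ hτ => by
      rw [norm_smul, Real.norm_of_nonneg (Real.exp_pos _).le, ← mul_one (Real.exp (k * t))]
      gcongr
      · exact hτ.2
      · exact hφ.norm_expOp_le hb τ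
  have hbd1 : ∀ t ∈ Icc (0 : ℝ) 1, ‖Real.exp (k * t) • expOp φ t‖ ≤ kernelConst k :=
    fun t ht => by
      refine (hbd 1 t ht).trans ?_
      rw [mul_one, kernelConst]
      have h2 : 0 ≤ 2 * (k * Real.exp k) := by positivity
      nlinarith [Real.exp_pos k]
  have hcommS : ∀ f t x, φ f ((Real.exp (k * t) • expOp φ t) x) =
      (Real.exp (k * t) • expOp φ t) (φ f x) := fun f t x => by
    have h := congrArg (fun L : X →L[𝕜] X => L x) (hφ.commute_expOp f t)
    simp only [mul_apply_eq_comp] at h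
    rw [_root_.smul_apply, _root_.smul_apply, real_smul_eq (𝕜 := 𝕜), map_smul, h,
      real_smul_eq (𝕜 := 𝕜)]
  have hα' : α ∈ Icc (0 : ℝ) 1 := ⟨hα.1, hα.2.le⟩
  have hk0 := hφ.isPowerKernel hk zero_mem_Icc_zero_one
  have hk1 := hφ.isPowerKernel hk one_mem_Icc_zero_one
  rw [powFun_zero, hφ.map_one] at hk0
  rw [hφ.map_id] at hk1
  have hk0' : IsPowerKernel (fun t => Real.exp (k * t) • expOp φ t) (kernelConst k) 0 1
      (fun t => Real.exp (k * t) • expOp φ t) := by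
    have heq : ∀ t, 0 < t → Real.exp (k * t) • φ (kernel b 0 t) = Real.exp (k * t) • expOp φ t :=
      fun t ht => by rw [expOp_of_pos ht]
    refine ⟨fun t _ => one_mul _, hk0.cont.congr fun t ht => (heq t ht.1).symm, fun t ht => ?_,
      fun θ hθ t h ht hh hth => ?_⟩
    · have := hk0.bound t ht
      rwa [heq t ht.1] at this
    · have := hk0.holder θ hθ t h ht hh hth
      rwa [heq t ht, heq (t + h) (by linarith)] at this
  obtain ⟨Q, hQ⟩ := exists_integral_eq (S := fun t => Real.exp (k * t) • expOp φ t) h₁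
    (fun t x => by rw [← hφ.map_id]; exact hcommS _ t x) hc0.exp_smul hgen.exp_smul hbd1 hk0'.cont
  refine ⟨kernelConst k, fun t => Real.exp (k * t) • expOp φ t, _, _, _, R, Q,
    one_le_kernelConst hk, hc0.exp_smul, hgen.exp_smul, hbd1, fun t _ => ⟨_, hbd t⟩,
    fun t ht => Parabolic.semigroup_eq hA.dense_domain hc0.exp_smul hgen.exp_smul ht (hbd t),
    hk0', hφ.isPowerKernel hk hα', hk1, fun t _ x => hcommS _ t x, ?_, hRinj,
    fun u => hφ.negPow_eq hb hSB hα.1 u, fun u => ?_, hrange, hQ⟩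
  · intro x y hxy
    refine hRinj ?_
    have : R = φ (powFun b (1 - α)) * φ (powFun b α) := by
      rw [← hφ.map_mul, powFun_mul_powFun (by linarith [hα.2]) hα.1, sub_add_cancel, hφ.map_id]
    rw [this, mul_apply_eq_comp, mul_apply_eq_comp, hxy]
  · rw [hφ.negPow_eq hb hSB zero_le_one u, hφ.map_id]

end SelfAdjoint

/-! ### Singular integrals and regularity of mild solutions -/

section SingularIntegrals

theorem intervalIntegrable_sub_rpow {a : ℝ} (ha : a < 1) (t x y : ℝ) :
    IntervalIntegrable (fun s => (t - s) ^ (-a)) volume x y := by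
  have h := (intervalIntegral.intervalIntegrable_rpow' (a := t - x) (b := t - y)
    (r := -a) (by linarith)).comp_sub_left t
  simpa using h

theorem integral_sub_rpow {a : ℝ} (ha : a < 1) (t x : ℝ) :
    ∫ s in x..t, (t - s) ^ (-a) = (t - x) ^ (1 - a) / (1 - a) := by
  rw [intervalIntegral.integral_comp_sub_left (fun s => s ^ (-a)), sub_self,
    integral_rpow (.inl (by linarith)), Real.zero_rpow (by linarith), sub_zero,
    neg_add_eq_sub]

variable {E : Type*} [NormedAddCommGroup E]

/-- A continuous function with an integrable power singularity at the right endpoint is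
integrable. -/
theorem intervalIntegrable_of_norm_le_rpow {f : ℝ → E} {a M x t : ℝ} (ha : a < 1) (hxt : x ≤ t)
    (hf : ContinuousOn f (Ico x t)) (hM : ∀ s ∈ Ico x t, ‖f s‖ ≤ M * (t - s) ^ (-a)) :
    IntervalIntegrable f volume x t := by
  rw [intervalIntegrable_iff_integrableOn_Ico_of_le hxt]
  have h1 := (intervalIntegrable_sub_rpow ha t x t).const_mul M
  rw [intervalIntegrable_iff_integrableOn_Ico_of_le hxt] at h1
  exact Integrable.mono' h1 (hf.aestronglyMeasurable measurableSet_Ico)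
    ((ae_restrict_iff' measurableSet_Ico).2 (.of_forall hM))

variable [NormedSpace ℝ E]

theorem norm_integral_le_of_norm_le_rpow {f : ℝ → E} {a M x t : ℝ} (ha : a < 1) (hxt : x ≤ t)
    (hM : ∀ s ∈ Ico x t, ‖f s‖ ≤ M * (t - s) ^ (-a)) :
    ‖∫ s in x..t, f s‖ ≤ M * (t - x) ^ (1 - a) / (1 - a) := by
  have h := intervalIntegral.norm_integral_le_of_norm_le (f := f) (μ := volume) hxt
    (g := fun s => M * (t - s) ^ (-a)) ?_ ((intervalIntegrable_sub_rpow ha t x t).const_mul M)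
  · rwa [intervalIntegral.integral_const_mul, integral_sub_rpow ha, ← mul_div_assoc] at h
  · have : ∀ᵐ s : ℝ, s ≠ t := by simp [ae_iff, measure_singleton]
    filter_upwards [this] with s hs hs'
    exact hM s ⟨hs'.1.le, lt_of_le_of_ne hs'.2 hs⟩

theorem integral_rpow_mul_exp_le {a l t : ℝ} (ha : a < 1) (hl : 0 < l) (ht : 0 ≤ t) :
    ∫ s in (0 : ℝ)..t, (t - s) ^ (-a) * Real.exp (-(l * (t - s))) ≤
      (1 / l) ^ (1 - a) * Real.Gamma (1 - a) := by
  have h0 := Real.integral_rpow_mul_exp_neg_mul_Ioi (a := 1 - a) (by linarith) hl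
  have hint : IntegrableOn (fun s : ℝ => s ^ (1 - a - 1) * Real.exp (-(l * s))) (Ioi 0) := by
    by_contra h
    rw [integral_undef h] at h0
    have := Real.Gamma_pos_of_pos (show 0 < 1 - a by linarith)
    have : 0 < (1 / l) ^ (1 - a) * Real.Gamma (1 - a) := by positivity
    linarith
  rw [← h0, intervalIntegral.integral_comp_sub_left (fun s => s ^ (-a) * Real.exp (-(l * s))),
    sub_self, sub_zero, intervalIntegral.integral_of_le ht]
  have h1 : (1 - a - 1) = -a := by ring
  rw [h1] at hint ⊢
  refine setIntegral_mono_set hint ?_ (Ioc_subset_Ioi_self).eventuallyLE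
  refine (ae_restrict_iff' measurableSet_Ioi).2 (.of_forall fun s hs => ?_)
  have : 0 < s := hs
  simp only [Pi.zero_apply]
  positivity

/-- The singular Gronwall inequality: `f(t) ≤ c + M ∫₀ᵗ (t - s)^{-a} f(s) ds` on `[0, T]`, `T ≤ 1`,
implies `f ≤ Λ c` with a constant `Λ` that depends only on `a` and `M`. -/
theorem exists_singular_gronwall {a M : ℝ} (ha : a < 1) (hM : 0 ≤ M) :
    ∃ Λ : ℝ, 0 ≤ Λ ∧ ∀ (T c : ℝ) (f : ℝ → ℝ), T ≤ 1 → 0 ≤ c → ContinuousOn f (Icc 0 T) →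
      (∀ t ∈ Icc 0 T, 0 ≤ f t) →
      (∀ t ∈ Icc 0 T, f t ≤ c + M * ∫ s in (0 : ℝ)..t, (t - s) ^ (-a) * f s) →
      ∀ t ∈ Icc 0 T, f t ≤ Λ * c := by
  have ha' : 0 < 1 - a := by linarith
  have hΓ := Real.Gamma_pos_of_pos ha'
  -- in the weighted norm `sup e^{-lt} |f(t)|` the integral operator has norm at most `1 / 2`
  set N := 2 * (M * Real.Gamma (1 - a) + 1) with hN
  have hN0 : 0 < N := by positivity
  set l := N ^ (1 / (1 - a)) with hl
  have hl0 : 0 < l := by positivity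
  have hlN : (1 / l) ^ (1 - a) = 1 / N := by
    rw [Real.div_rpow zero_le_one hl0.le, Real.one_rpow, hl, ← Real.rpow_mul hN0.le,
      one_div_mul_cancel ha'.ne', Real.rpow_one]
  refine ⟨2 * Real.exp l, by positivity, fun T c f hT hc hf hf0 hfle t ht => ?_⟩
  have hcont : ContinuousOn (fun t => Real.exp (-(l * t)) * f t) (Icc 0 T) := by
    have h1 : Continuous fun t : ℝ => Real.exp (-(l * t)) := by fun_prop
    exact h1.continuousOn.mul hf
  obtain ⟨t₀, ht₀, hmax⟩ := isCompact_Icc.exists_isMaxOn ⟨t, ht⟩ hcont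
  set m := Real.exp (-(l * t₀)) * f t₀ with hm
  have hm0 : 0 ≤ m := mul_nonneg (Real.exp_pos _).le (hf0 _ ht₀)
  have hfm : ∀ s ∈ Icc 0 T, f s ≤ Real.exp (l * s) * m := fun s hs => by
    have h1 : Real.exp (-(l * s)) * f s ≤ m := hmax hs
    rwa [Real.exp_neg, inv_mul_le_iff₀ (Real.exp_pos _)] at h1
  have hsub : Icc 0 t₀ ⊆ Icc 0 T := Icc_subset_Icc_right ht₀.2
  have hint1 : IntervalIntegrable (fun s => (t₀ - s) ^ (-a) * f s) volume 0 t₀ := by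
    refine (intervalIntegrable_sub_rpow ha t₀ 0 t₀).mul_continuousOn ?_
    rw [uIcc_of_le ht₀.1]; exact hf.mono hsub
  have hint2 : IntervalIntegrable (fun s => (t₀ - s) ^ (-a) * Real.exp (-(l * (t₀ - s))))
      volume 0 t₀ := by
    refine (intervalIntegrable_sub_rpow ha t₀ 0 t₀).mul_continuousOn ?_
    have h1 : Continuous fun s : ℝ => Real.exp (-(l * (t₀ - s))) := by fun_prop
    exact h1.continuousOn
  have h2 : ∫ s in (0 : ℝ)..t₀, (t₀ - s) ^ (-a) * f s ≤
      Real.exp (l * t₀) * m * (1 / N * Real.Gamma (1 - a)) := by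
    calc _ ≤ ∫ s in (0 : ℝ)..t₀, Real.exp (l * t₀) * m *
          ((t₀ - s) ^ (-a) * Real.exp (-(l * (t₀ - s)))) := by
          refine intervalIntegral.integral_mono_on ht₀.1 hint1 (hint2.const_mul _) fun s hs => ?_
          have h3 := hfm s (hsub hs)
          have h4 : Real.exp (l * t₀) * Real.exp (-(l * (t₀ - s))) = Real.exp (l * s) := by
            rw [← Real.exp_add]; congr 1; ring
          have h5 : 0 ≤ (t₀ - s) ^ (-a) := Real.rpow_nonneg (sub_nonneg.2 hs.2) _
          calc (t₀ - s) ^ (-a) * f s ≤ (t₀ - s) ^ (-a) * (Real.exp (l * s) * m) := by gcongr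
            _ = _ := by rw [← h4]; ring
      _ ≤ _ := by
          rw [intervalIntegral.integral_const_mul, ← hlN]
          gcongr
          exact integral_rpow_mul_exp_le ha hl0 ht₀.1
  have h3 := hfle t₀ ht₀
  have h4 : M * (1 / N * Real.Gamma (1 - a)) ≤ 1 / 2 := by
    rw [hN]
    have h5 : 0 ≤ M * Real.Gamma (1 - a) := by positivity
    have h6 : M * (1 / (2 * (M * Real.Gamma (1 - a) + 1)) * Real.Gamma (1 - a)) =
        M * Real.Gamma (1 - a) / (2 * (M * Real.Gamma (1 - a) + 1)) := by ring
    rw [h6, div_le_div_iff₀ (by positivity) (by norm_num)]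
    linarith
  have h5 : f t₀ ≤ c + Real.exp (l * t₀) * m * (1 / 2) := by
    calc f t₀ ≤ c + M * (Real.exp (l * t₀) * m * (1 / N * Real.Gamma (1 - a))) :=
          h3.trans (by gcongr)
      _ = c + Real.exp (l * t₀) * m * (M * (1 / N * Real.Gamma (1 - a))) := by ring
      _ ≤ _ := by gcongr
  have h6 : m ≤ 2 * c := by
    have h7 : Real.exp (-(l * t₀)) * Real.exp (l * t₀) = 1 := by
      rw [← Real.exp_add, neg_add_cancel, Real.exp_zero]
    have h8 : Real.exp (-(l * t₀)) ≤ 1 := Real.exp_le_one_iff.2 (by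
      have := mul_nonneg hl0.le ht₀.1; linarith)
    have h9 : m ≤ Real.exp (-(l * t₀)) * (c + Real.exp (l * t₀) * m * (1 / 2)) := by
      rw [hm]; gcongr
    have h10 : Real.exp (-(l * t₀)) * (c + Real.exp (l * t₀) * m * (1 / 2)) =
        Real.exp (-(l * t₀)) * c + (Real.exp (-(l * t₀)) * Real.exp (l * t₀)) * (m / 2) := by ring
    rw [h10, h7] at h9
    have h11 : Real.exp (-(l * t₀)) * c ≤ c := mul_le_of_le_one_left hc h8
    linarith
  calc f t ≤ Real.exp (l * t) * m := hfm t ht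
    _ ≤ Real.exp l * (2 * c) := by
        gcongr
        exact mul_le_of_le_one_right hl0.le (ht.2.trans hT)
    _ = _ := by ring

end SingularIntegrals

section VariationOfConstants

variable {𝕜 X : Type*} [RCLike 𝕜] [NormedAddCommGroup X] [InnerProductSpace 𝕜 X]

theorem IsPowerKernel.continuousOn_apply {S P : ℝ → X →L[𝕜] X} {C a : ℝ} {J : X →L[𝕜] X}
    (hP : IsPowerKernel S C a J P) {t : ℝ} (ht : t ≤ 1) {G : ℝ → X}
    (hG : ContinuousOn G (Icc 0 t)) : ContinuousOn (fun s => P (t - s) (G s)) (Ico 0 t) := by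
  have h1 : ContinuousOn (fun s => P (t - s)) (Ico 0 t) := by
    refine hP.cont.comp (by fun_prop) fun s hs => ?_
    exact ⟨sub_pos.2 hs.2, by linarith [hs.1]⟩
  exact h1.clm_apply (hG.mono Ico_subset_Icc_self)

theorem IsPowerKernel.norm_apply_le {S P : ℝ → X →L[𝕜] X} {C a : ℝ} {J : X →L[𝕜] X}
    (hP : IsPowerKernel S C a J P) {t s : ℝ} (ht : t ≤ 1) (hs : s ∈ Ico 0 t) (x : X) :
    ‖P (t - s) x‖ ≤ C * ‖x‖ * (t - s) ^ (-a) := by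
  calc _ ≤ ‖P (t - s)‖ * ‖x‖ := (P (t - s)).le_opNorm _
    _ ≤ C * (t - s) ^ (-a) * ‖x‖ := by
        gcongr
        exact hP.bound _ ⟨sub_pos.2 hs.2, by linarith [hs.1]⟩
    _ = _ := by ring

theorem IsPowerKernel.intervalIntegrable {S P : ℝ → X →L[𝕜] X} {C a : ℝ} {J : X →L[𝕜] X}
    (hP : IsPowerKernel S C a J P) (hC : 0 ≤ C) (ha : a < 1) {t : ℝ} (ht0 : 0 ≤ t) (ht : t ≤ 1)
    {G : ℝ → X} (hG : ContinuousOn G (Icc 0 t)) :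
    IntervalIntegrable (fun s => P (t - s) (G s)) volume 0 t := by
  obtain ⟨M, hM⟩ := isCompact_Icc.exists_bound_of_continuousOn hG
  refine intervalIntegrable_of_norm_le_rpow (M := C * M) ha ht0 (hP.continuousOn_apply ht hG)
    fun s hs => ?_
  have h0 : 0 < t - s := sub_pos.2 hs.2
  refine (hP.norm_apply_le ht hs _).trans ?_
  gcongr
  exact hM s (Ico_subset_Icc_self hs)

variable [NormedSpace ℝ X]

/-- `w` satisfies the variation of constants formula with forcing term `G` on `[0, T]`. In the
application `w = B^α u` and `G = g(u)` for a mild solution `u`. -/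
structure IsVOC (S P : ℝ → X →L[𝕜] X) (T : ℝ) (w G : ℝ → X) : Prop where
  cont : ContinuousOn w (Icc 0 T)
  cont_forcing : ContinuousOn G (Icc 0 T)
  eq : ∀ t ∈ Icc 0 T, w t = S t (w 0) + ∫ s in (0 : ℝ)..t, P (t - s) (G s)

variable {A : X →ₗ.[𝕜] X} {k α C : ℝ} {S P D : ℝ → X →L[𝕜] X} {J R Q : X →L[𝕜] X}

theorem IsParabolic.norm_D_apply_le (hp : IsParabolic A k α C S P D J R Q) {θ H : ℝ}
    {F : ℝ → X} {s : ℝ} (hs : s ∈ Ico (0 : ℝ) 1) (hF : ‖F s‖ ≤ H * (1 - s) ^ θ) :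
    ‖D (1 - s) (F s)‖ ≤ C * H * (1 - s) ^ (-(1 - θ)) := by
  have hC : 0 ≤ C := zero_le_one.trans hp.one_le
  have h0 : 0 < 1 - s := sub_pos.2 hs.2
  refine (hp.kernel_one.norm_apply_le le_rfl hs _).trans ?_
  calc C * ‖F s‖ * (1 - s) ^ (-(1 : ℝ)) ≤ C * (H * (1 - s) ^ θ) * (1 - s) ^ (-(1 : ℝ)) := by gcongr
    _ = C * H * ((1 - s) ^ θ * (1 - s) ^ (-(1 : ℝ))) := by ring
    _ = _ := by rw [← Real.rpow_add h0]; congr 2; ring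

/-- Lipschitz dependence on the initial value. -/
theorem IsParabolic.exists_lipschitz (hp : IsParabolic A k α C S P D J R Q) (hα : α < 1) {L : ℝ}
    (hL : 0 ≤ L) : ∃ Λ : ℝ, 0 ≤ Λ ∧ ∀ (T : ℝ) (w w' G G' : ℝ → X), T ≤ 1 → IsVOC S P T w G →
      IsVOC S P T w' G' → (∀ s ∈ Icc 0 T, ‖G s - G' s‖ ≤ L * ‖w s - w' s‖) →
      ∀ t ∈ Icc 0 T, ‖w t - w' t‖ ≤ Λ * ‖w 0 - w' 0‖ := by
  have hC : 0 ≤ C := zero_le_one.trans hp.one_le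
  obtain ⟨Λ, hΛ0, hΛ⟩ := exists_singular_gronwall hα (mul_nonneg hC hL)
  refine ⟨Λ * C, by positivity, fun T w w' G G' hT hw hw' hG t ht => ?_⟩
  rw [mul_assoc]
  have hcont : ContinuousOn (fun t => ‖w t - w' t‖) (Icc 0 T) := (hw.cont.sub hw'.cont).norm
  refine hΛ T (C * ‖w 0 - w' 0‖) (fun t => ‖w t - w' t‖) hT (by positivity) hcont
    (fun t _ => norm_nonneg _) (fun t ht => ?_) t ht
  have ht1 : t ≤ 1 := ht.2.trans hT
  have hsub : Icc 0 t ⊆ Icc 0 T := Icc_subset_Icc_right ht.2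
  have h1 : w t - w' t = S t (w 0 - w' 0) + ∫ s in (0 : ℝ)..t, P (t - s) (G s - G' s) := by
    simp only [map_sub]
    rw [intervalIntegral.integral_sub
      (hp.kernel_frac.intervalIntegrable hC hα ht.1 ht1 (hw.cont_forcing.mono hsub))
      (hp.kernel_frac.intervalIntegrable hC hα ht.1 ht1 (hw'.cont_forcing.mono hsub)),
      hw.eq t ht, hw'.eq t ht]
    abel
  rw [h1]
  refine (norm_add_le _ _).trans (add_le_add ?_ ?_)
  · exact ((S t).le_opNorm _).trans (by gcongr; exact hp.norm_le t ⟨ht.1, ht1⟩)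
  · rw [← intervalIntegral.integral_const_mul]
    refine intervalIntegral.norm_integral_le_of_norm_le ht.1 ?_ ?_
    · have : ∀ᵐ s : ℝ, s ≠ t := by simp [ae_iff, measure_singleton]
      filter_upwards [this] with s hs hs'
      have hs2 : s ∈ Ico 0 t := ⟨hs'.1.le, lt_of_le_of_ne hs'.2 hs⟩
      have h0 : 0 < t - s := sub_pos.2 hs2.2
      refine (hp.kernel_frac.norm_apply_le ht1 hs2 _).trans ?_
      calc C * ‖G s - G' s‖ * (t - s) ^ (-α) ≤ C * (L * ‖w s - w' s‖) * (t - s) ^ (-α) := by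
            gcongr
            exact hG s (hsub (Ico_subset_Icc_self hs2))
        _ = _ := by ring
    · refine ((intervalIntegrable_sub_rpow hα t 0 t).mul_continuousOn ?_).const_mul _
      rw [uIcc_of_le ht.1]; exact hcont.mono hsub

/-- Hölder continuity at the right endpoint, with exponent `(1 - α) / 2`. -/
theorem IsParabolic.norm_sub_le (hp : IsParabolic A k α C S P D J R Q)
    (hα : α ∈ Ico (0 : ℝ) 1) {θ M : ℝ} (hθ : θ = (1 - α) / 2) (hM : 0 ≤ M) {w G : ℝ → X}
    (hw : IsVOC S P 1 w G) (hw0 : ‖w 0‖ ≤ M) (hG : ∀ s ∈ Icc (0 : ℝ) 1, ‖G s‖ ≤ M) {s : ℝ}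
    (hs : s ∈ Icc (1 / 2 : ℝ) 1) : ‖w s - w 1‖ ≤ C * M * (2 + 2 / θ) * (1 - s) ^ θ := by
  have hC : 0 ≤ C := zero_le_one.trans hp.one_le
  have hθ0 : 0 < θ := by rw [hθ]; linarith [hα.2]
  have hθ1 : θ ≤ 1 := by rw [hθ]; linarith [hα.1]
  have hs0 : 0 < s := by linarith [hs.1]
  set h := 1 - s with hh
  have hh0 : 0 ≤ h := by linarith [hs.2]
  have hsI : s ∈ Icc (0 : ℝ) 1 := ⟨hs0.le, hs.2⟩
  have hint := hp.kernel_frac.intervalIntegrable hC hα.2 zero_le_one le_rfl hw.cont_forcing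
  have hint1 : IntervalIntegrable (fun r => P (1 - r) (G r)) volume 0 s :=
    hint.mono_set (by
      rw [uIcc_of_le hs0.le, uIcc_of_le zero_le_one]; exact Icc_subset_Icc_right hs.2)
  have hint2 : IntervalIntegrable (fun r => P (1 - r) (G r)) volume s 1 :=
    hint.mono_set (by
      rw [uIcc_of_le hs.2, uIcc_of_le zero_le_one]; exact Icc_subset_Icc_left hs0.le)
  have hint3 := hp.kernel_frac.intervalIntegrable hC hα.2 hs0.le hs.2
    (hw.cont_forcing.mono (Icc_subset_Icc_right hs.2))
  have h1 : w 1 - w s = (S 1 - S s) (w 0) + ((∫ r in (0 : ℝ)..s, (P (1 - r) - P (s - r)) (G r)) +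
      ∫ r in s..1, P (1 - r) (G r)) := by
    simp only [_root_.sub_apply]
    rw [intervalIntegral.integral_sub hint1 hint3, hw.eq 1 ⟨zero_le_one, le_rfl⟩, hw.eq s hsI,
      ← intervalIntegral.integral_add_adjacent_intervals hint1 hint2]
    abel
  have e1 : ‖(S 1 - S s) (w 0)‖ ≤ C * M * 2 * h ^ θ := by
    have h2 := hp.kernel_zero.holder θ ⟨hθ0.le, hθ1⟩ s h hs0 hh0 (by rw [hh]; linarith)
    rw [hh, add_sub_cancel, ← hh, zero_add] at h2
    have h3 : s ^ (-θ) ≤ 2 := by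
      rw [Real.rpow_neg hs0.le, inv_le_comm₀ (by positivity) (by norm_num)]
      calc (2 : ℝ)⁻¹ ≤ s := by linarith [hs.1]
        _ = s ^ (1 : ℝ) := (Real.rpow_one s).symm
        _ ≤ s ^ θ := Real.rpow_le_rpow_of_exponent_ge hs0 hs.2 hθ1
    calc _ ≤ ‖S 1 - S s‖ * ‖w 0‖ := (S 1 - S s).le_opNorm _
      _ ≤ C * h ^ θ * 2 * M := by
          gcongr
          exact h2.trans (by gcongr)
      _ = _ := by ring
  have e2 : ‖∫ r in (0 : ℝ)..s, (P (1 - r) - P (s - r)) (G r)‖ ≤ C * M * (1 / θ) * h ^ θ := by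
    have h2 := norm_integral_le_of_norm_le_rpow (f := fun r => (P (1 - r) - P (s - r)) (G r))
      (a := α + θ) (M := C * h ^ θ * M) (x := 0) (t := s) (by rw [hθ]; linarith [hα.2])
      hs0.le (fun r hr => by
        have h3 := hp.kernel_frac.holder θ ⟨hθ0.le, hθ1⟩ (s - r) h (sub_pos.2 hr.2) hh0
          (by rw [hh]; linarith [hr.1])
        have h4 : s - r + h = 1 - r := by rw [hh]; ring
        have h0 : 0 < s - r := sub_pos.2 hr.2
        rw [h4] at h3
        calc _ ≤ ‖P (1 - r) - P (s - r)‖ * ‖G r‖ := (P (1 - r) - P (s - r)).le_opNorm _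
          _ ≤ C * h ^ θ * (s - r) ^ (-(α + θ)) * M := by
              gcongr
              exact hG r ⟨hr.1, hr.2.le.trans hs.2⟩
          _ = _ := by ring)
    have h5 : 1 - (α + θ) = θ := by rw [hθ]; ring
    rw [h5, sub_zero] at h2
    refine h2.trans ?_
    have h6 : s ^ θ ≤ 1 := Real.rpow_le_one hs0.le hs.2 hθ0.le
    calc C * h ^ θ * M * s ^ θ / θ ≤ C * h ^ θ * M * 1 / θ := by gcongr
      _ = _ := by ring
  have e3 : ‖∫ r in s..1, P (1 - r) (G r)‖ ≤ C * M * (1 / θ) * h ^ θ := by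
    have h2 := norm_integral_le_of_norm_le_rpow (f := fun r => P (1 - r) (G r))
      (a := α) (M := C * M) (x := s) (t := 1) hα.2 hs.2
      (fun r hr => by
        have h0 : 0 < 1 - r := sub_pos.2 hr.2
        have hr0 : 0 ≤ r := hs0.le.trans hr.1
        refine (hp.kernel_frac.norm_apply_le le_rfl ⟨hr0, hr.2⟩ _).trans ?_
        gcongr
        exact hG r ⟨hr0, hr.2.le⟩)
    have h5 : 1 - α = θ + θ := by rw [hθ]; ring
    rw [h5, ← hh] at h2
    refine h2.trans ?_
    have h6 : h ^ (θ + θ) ≤ h ^ θ := by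
      rw [Real.rpow_add_of_nonneg hh0 hθ0.le hθ0.le]
      exact mul_le_of_le_one_right (by positivity)
        (Real.rpow_le_one hh0 (by rw [hh]; linarith) hθ0.le)
    calc C * M * h ^ (θ + θ) / (θ + θ) ≤ C * M * h ^ θ / θ := by
          gcongr
          linarith
      _ = _ := by ring
  rw [norm_sub_rev, h1]
  calc _ ≤ C * M * 2 * h ^ θ + (C * M * (1 / θ) * h ^ θ + C * M * (1 / θ) * h ^ θ) :=
        (norm_add_le _ _).trans (add_le_add e1 ((norm_add_le _ _).trans (add_le_add e2 e3)))
    _ = _ := by ring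

/-- The value of `B u(1)`, for the mild solution `u` with initial value `x` and forcing term `G`.
The singularity of `B S(1 - s)` at `s = 1` is compensated by the Hölder continuity of `G`. -/
def regularValue (D : ℝ → X →L[𝕜] X) (Q : X →L[𝕜] X) (x : X) (G : ℝ → X) : X :=
  D 1 x + (∫ s in (0 : ℝ)..1, D (1 - s) (G s - G 1)) + Q (G 1)

theorem IsParabolic.intervalIntegrable_D (hp : IsParabolic A k α C S P D J R Q) {θ H : ℝ}
    (hθ : 0 < θ) {G : ℝ → X} (hG : ContinuousOn G (Icc 0 1))
    (hH : ∀ s ∈ Icc (0 : ℝ) 1, ‖G s - G 1‖ ≤ H * (1 - s) ^ θ) :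
    IntervalIntegrable (fun s => D (1 - s) (G s - G 1)) volume 0 1 :=
  intervalIntegrable_of_norm_le_rpow (a := 1 - θ) (by linarith) zero_le_one
    (hp.kernel_one.continuousOn_apply le_rfl (hG.sub continuousOn_const))
    fun _ hs => hp.norm_D_apply_le (F := fun s => G s - G 1) hs (hH _ (Ico_subset_Icc_self hs))

/-- `B u(1)` depends Hölder continuously on the initial value and the forcing term: since
`‖(G - G')(s) - (G - G')(1)‖` is bounded both by `2 H (1 - s)^θ` and by `2 δ`, it is bounded by
the geometric mean of these, which still compensates the singularity of `B S(1 - s)`. -/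
theorem IsParabolic.norm_regularValue_sub_le (hp : IsParabolic A k α C S P D J R Q) {θ H δ : ℝ}
    (hθ : 0 < θ) (hH0 : 0 ≤ H) (hδ : 0 ≤ δ) {G G' : ℝ → X} (hG : ContinuousOn G (Icc 0 1))
    (hG' : ContinuousOn G' (Icc 0 1))
    (hH : ∀ s ∈ Icc (0 : ℝ) 1, ‖G s - G 1‖ ≤ H * (1 - s) ^ θ)
    (hH' : ∀ s ∈ Icc (0 : ℝ) 1, ‖G' s - G' 1‖ ≤ H * (1 - s) ^ θ)
    (hd : ∀ s ∈ Icc (0 : ℝ) 1, ‖G s - G' s‖ ≤ δ) (x x' : X) :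
    ‖regularValue D Q x G - regularValue D Q x' G'‖ ≤
      C * ‖x - x'‖ + C * (2 * (√H * √δ)) * (2 / θ) + ‖Q‖ * δ := by
  have hC : 0 ≤ C := zero_le_one.trans hp.one_le
  have hint := hp.intervalIntegrable_D hθ hG hH
  have hint' := hp.intervalIntegrable_D hθ hG' hH'
  have h1 : regularValue D Q x G - regularValue D Q x' G' = D 1 (x - x') +
      (∫ s in (0 : ℝ)..1, D (1 - s) ((G s - G' s) - (G 1 - G' 1))) + Q (G 1 - G' 1) := by
    have h2 : ∀ s, D (1 - s) ((G s - G' s) - (G 1 - G' 1)) =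
        D (1 - s) (G s - G 1) - D (1 - s) (G' s - G' 1) := fun s => by
      rw [← map_sub]; congr 1; abel
    simp only [h2]
    rw [intervalIntegral.integral_sub hint hint', regularValue, regularValue, map_sub, map_sub]
    abel
  have h1mem : (1 : ℝ) ∈ Icc (0 : ℝ) 1 := ⟨zero_le_one, le_rfl⟩
  rw [h1]
  refine (norm_add_le _ _).trans (add_le_add ((norm_add_le _ _).trans (add_le_add ?_ ?_)) ?_)
  · refine ((D 1).le_opNorm _).trans ?_
    gcongr
    simpa using hp.kernel_one.bound 1 ⟨zero_lt_one, le_rfl⟩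
  · have h2 := norm_integral_le_of_norm_le_rpow (a := 1 - θ / 2) (M := C * (2 * (√H * √δ)))
      (f := fun s => D (1 - s) ((G s - G' s) - (G 1 - G' 1))) (x := 0) (t := 1) (by linarith)
      zero_le_one (fun s hs => by
        refine hp.norm_D_apply_le (F := fun s => (G s - G' s) - (G 1 - G' 1)) hs ?_
        have hsI := Ico_subset_Icc_self hs
        have h0 : 0 < 1 - s := sub_pos.2 hs.2
        have e1 : ‖(G s - G' s) - (G 1 - G' 1)‖ ≤ 2 * (H * (1 - s) ^ θ) := by
          have : (G s - G' s) - (G 1 - G' 1) = (G s - G 1) - (G' s - G' 1) := by abel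
          rw [this]
          exact (_root_.norm_sub_le _ _).trans (by linarith [hH s hsI, hH' s hsI])
        have e2 : ‖(G s - G' s) - (G 1 - G' 1)‖ ≤ 2 * δ :=
          (_root_.norm_sub_le _ _).trans (by linarith [hd s hsI, hd 1 h1mem])
        refine abs_le_of_sq_le_sq' ?_ (by positivity) |>.2
        have e3 : ((1 - s) ^ (θ / 2)) ^ 2 = (1 - s) ^ θ := by
          rw [← Real.rpow_natCast, ← Real.rpow_mul h0.le]; congr 1; push_cast; ring
        calc ‖(G s - G' s) - (G 1 - G' 1)‖ ^ 2
            = ‖(G s - G' s) - (G 1 - G' 1)‖ * ‖(G s - G' s) - (G 1 - G' 1)‖ := sq _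
          _ ≤ 2 * (H * (1 - s) ^ θ) * (2 * δ) := by gcongr
          _ = (2 * (√H * √δ) * (1 - s) ^ (θ / 2)) ^ 2 := by
            rw [mul_pow, mul_pow, mul_pow, Real.sq_sqrt hH0, Real.sq_sqrt hδ, e3]; ring)
    refine h2.trans (le_of_eq ?_)
    rw [sub_zero, Real.one_rpow, mul_one, sub_sub_cancel, div_div_eq_mul_div, mul_div_assoc]
  · exact (Q.le_opNorm _).trans (by gcongr; exact hd 1 h1mem)

variable [CompleteSpace X]

theorem IsParabolic.eq_regularValue (hp : IsParabolic A k α C S P D J R Q) {θ H : ℝ}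
    (hθ : 0 < θ) {G : ℝ → X} (hG : ContinuousOn G (Icc 0 1))
    (hH : ∀ s ∈ Icc (0 : ℝ) 1, ‖G s - G 1‖ ≤ H * (1 - s) ^ θ) (x : X) :
    S 1 x + ∫ s in (0 : ℝ)..1, S (1 - s) (G s) = R (regularValue D Q x G) := by
  have hint := hp.intervalIntegrable_D hθ hG hH
  have hC : 0 ≤ C := zero_le_one.trans hp.one_le
  have h1 : ∫ s in (0 : ℝ)..1, S (1 - s) (G s) =
      (∫ s in (0 : ℝ)..1, S (1 - s) (G s - G 1)) + ∫ s in (0 : ℝ)..1, S (1 - s) (G 1) := by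
    rw [← intervalIntegral.integral_add
      (hp.kernel_zero.intervalIntegrable (G := fun s => G s - G 1) hC zero_lt_one zero_le_one
        le_rfl (hG.sub continuousOn_const))
      (hp.kernel_zero.intervalIntegrable hC zero_lt_one zero_le_one le_rfl continuousOn_const)]
    refine intervalIntegral.integral_congr fun s _ => ?_
    simp only [map_sub, sub_add_cancel]
  have h2 : ∫ s in (0 : ℝ)..1, S (1 - s) (G 1) = R (Q (G 1)) := by
    rw [← hp.integral_eq, intervalIntegral.integral_comp_sub_left (fun s => S s (G 1))]
    norm_num
  have h3 : ∫ s in (0 : ℝ)..1, S (1 - s) (G s - G 1) =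
      R (∫ s in (0 : ℝ)..1, D (1 - s) (G s - G 1)) := by
    rw [← R.intervalIntegral_comp_comm hint, intervalIntegral.integral_of_le zero_le_one,
      intervalIntegral.integral_of_le zero_le_one, integral_Ioc_eq_integral_Ioo,
      integral_Ioc_eq_integral_Ioo]
    refine setIntegral_congr_fun measurableSet_Ioo fun s hs => ?_
    rw [← hp.kernel_one.factor (1 - s) ⟨sub_pos.2 hs.2, by linarith [hs.1]⟩]
    rfl
  rw [h1, h2, h3, ← hp.kernel_one.factor 1 ⟨zero_lt_one, le_rfl⟩, regularValue, map_add, map_add,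
    mul_apply_eq_comp, add_assoc]

end VariationOfConstants

/-! ### Solutions, arcs and invariant sets -/

section Solutions

variable {𝕜 X : Type*} [RCLike 𝕜] [NormedAddCommGroup X] [InnerProductSpace 𝕜 X]
  [NormedSpace ℝ X]

theorem FracSpace.continuous_pow {B : X →ₗ.[𝕜] X} {α : ℝ} :
    Continuous (FracSpace.pow : FracSpace B α → X) :=
  Isometry.continuous (Isometry.of_dist_eq fun u v => by
    rw [FracSpace.dist_eq, dist_eq_norm])

theorem LipschitzOnBounded.continuous {Y Z : Type*} [MetricSpace Y] [MetricSpace Z] {g : Y → Z}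
    (hg : LipschitzOnBounded g) : Continuous g := by
  rw [continuous_iff_continuousAt]
  intro y
  obtain ⟨L, hL⟩ := hg (Metric.ball y 1) Metric.isBounded_ball
  exact hL.continuousOn.continuousAt (Metric.ball_mem_nhds y one_pos)

variable {A : X →ₗ.[𝕜] X} {k α C : ℝ} {S P D : ℝ → X →L[𝕜] X} {J R Q : X →L[𝕜] X}

theorem IsParabolic.J_pow (hp : IsParabolic A k α C S P D J R Q)
    (u : FracSpace (shift A k) α) : J u.pow = u.incl := by
  rw [← hp.negPow_frac, FracSpace.negPow_pow]

theorem IsParabolic.continuous_incl (hp : IsParabolic A k α C S P D J R Q) :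
    Continuous (FracSpace.incl : FracSpace (shift A k) α → X) := by
  have : (FracSpace.incl : FracSpace (shift A k) α → X) = fun u => J u.pow :=
    funext fun u => (hp.J_pow u).symm
  rw [this]
  exact J.continuous.comp FracSpace.continuous_pow

theorem IsParabolic.range_incl_one (hp : IsParabolic A k α C S P D J R Q) :
    Set.range (FracSpace.incl : FracSpace (shift A k) 1 → X) = (A.domain : Set X) := by
  rw [← hp.range_R]
  ext x
  constructor
  · rintro ⟨u, rfl⟩
    exact ⟨u.pow, by rw [← hp.negPow_one, FracSpace.negPow_pow]⟩
  · rintro ⟨y, rfl⟩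
    exact ⟨⟨R y, y, hp.negPow_one y⟩, rfl⟩

variable [CompleteSpace X]

/-- A mild solution `u` satisfies the variation of constants formula for `w = B^α u`. -/
theorem IsParabolic.isVOC (hp : IsParabolic A k α C S P D J R Q) (hα : α < 1)
    {g : FracSpace (shift A k) α → X} (hg : Continuous g) {T : ℝ} {u : ℝ → FracSpace (shift A k) α}
    (hu : IsMildSolution A g T u) {t : ℝ} (htT : t < T) (ht1 : t ≤ 1) :
    IsVOC S P t (fun s => (u s).pow) (fun s => g (u s)) := by
  have hC : 0 ≤ C := zero_le_one.trans hp.one_le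
  have hsub : Icc 0 t ⊆ Ico 0 T := fun s hs => ⟨hs.1, hs.2.trans_lt htT⟩
  have hGc : ContinuousOn (fun s => g (u s)) (Icc 0 t) := hg.comp_continuousOn (hu.1.mono hsub)
  refine ⟨FracSpace.continuous_pow.comp_continuousOn (hu.1.mono hsub), hGc, fun r hr => hp.J_inj ?_⟩
  have hr1 : r ≤ 1 := hr.2.trans ht1
  have hint := hp.kernel_frac.intervalIntegrable hC hα hr.1 hr1
    (hGc.mono (Icc_subset_Icc_right hr.2))
  rw [hp.J_pow, hu.2 r (hsub hr), map_add, hp.comm r hr.1, hp.J_pow, hp.semigroup_eq r hr.1,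
    ← J.intervalIntegral_comp_comm hint, intervalIntegral.integral_of_le hr.1,
    intervalIntegral.integral_of_le hr.1, integral_Ioc_eq_integral_Ioo,
    integral_Ioc_eq_integral_Ioo]
  congr 1
  refine setIntegral_congr_fun measurableSet_Ioo fun s hs => ?_
  have h0 : 0 < r - s := sub_pos.2 hs.2
  rw [hp.semigroup_eq _ h0.le, ← hp.kernel_frac.factor (r - s) ⟨h0, by linarith [hs.1]⟩]
  rfl

theorem IsParabolic.mild_unique (hp : IsParabolic A k α C S P D J R Q) (hα : α < 1)
    {g : FracSpace (shift A k) α → X} (hg : LipschitzOnBounded g) {T T' : ℝ}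
    {u u' : ℝ → FracSpace (shift A k) α} (hu : IsMildSolution A g T u)
    (hu' : IsMildSolution A g T' u') (h0 : u 0 = u' 0) {t : ℝ} (ht0 : 0 ≤ t) (ht1 : t ≤ 1)
    (htT : t < T) (htT' : t < T') : u t = u' t := by
  have hw := hp.isVOC hα hg.continuous hu htT ht1
  have hw' := hp.isVOC hα hg.continuous hu' htT' ht1
  have hb : Bornology.IsBounded (u '' Icc 0 t ∪ u' '' Icc 0 t) := by
    refine (IsCompact.union ?_ ?_).isBounded
    · exact isCompact_Icc.image_of_continuousOn
        (hu.1.mono fun s hs => ⟨hs.1, hs.2.trans_lt htT⟩)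
    · exact isCompact_Icc.image_of_continuousOn
        (hu'.1.mono fun s hs => ⟨hs.1, hs.2.trans_lt htT'⟩)
  obtain ⟨L, hL⟩ := hg _ hb
  obtain ⟨Λ, -, hΛ⟩ := hp.exists_lipschitz hα L.2
  have h := hΛ t _ _ _ _ ht1 hw hw' (fun s hs => by
    have := hL.dist_le_mul (u s) (.inl ⟨s, hs, rfl⟩) (u' s) (.inr ⟨s, hs, rfl⟩)
    rwa [dist_eq_norm, FracSpace.dist_eq] at this) t ⟨ht0, le_rfl⟩
  rw [h0, sub_self, norm_zero, mul_zero] at h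
  exact FracSpace.pow_injective (sub_eq_zero.1 (norm_le_zero_iff.1 h))

variable [IsScalarTower ℝ 𝕜 X]

/-- Classical solutions are mild solutions. -/
theorem IsParabolic.isMildSolution (hp : IsParabolic A k α C S P D J R Q)
    {g : FracSpace (shift A k) α → X} (hg : Continuous g) {T : ℝ} {u : ℝ → FracSpace (shift A k) α}
    (hu : IsClassicalSolution A g T u) : IsMildSolution A g T u := by
  refine ⟨hu.1, fun t ht => ?_⟩
  obtain ⟨M, hM⟩ := hp.bounded t ht.1
  have hsub : Icc 0 t ⊆ Ico 0 T := fun s hs => ⟨hs.1, hs.2.trans_lt ht.2⟩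
  have h := hp.isGenerator.eq_add_integral hp.isC0Semigroup ht.1 hM
    (v := fun s => (u s).incl) (f := fun s => g (u s))
    (hp.continuous_incl.comp_continuousOn (hu.1.mono hsub))
    (hg.comp_continuousOn (hu.1.mono hsub)) (fun s hs => by
      obtain ⟨hd, hder⟩ := hu.2 s ⟨hs.1, hs.2.trans ht.2⟩
      refine ⟨hd, ?_⟩
      rw [LinearPMap.neg_apply, neg_add_eq_sub]
      exact hder.hasDerivWithinAt)
  rw [h, hp.semigroup_eq t ht.1]
  congr 1
  refine intervalIntegral.integral_congr fun s hs => ?_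
  rw [uIcc_of_le ht.1] at hs
  simp only [hp.semigroup_eq (t - s) (sub_nonneg.2 hs.2)]

end Solutions

section Invariant

theorem exists_solution_of_mem_localSemiflow {Y : Type*} {Sol : ℝ → (ℝ → Y) → Prop} {t : ℝ}
    {x y : Y} (h : y ∈ localSemiflow Sol t x) : ∃ u T, t < T ∧ Sol T u ∧ u 0 = x ∧ u t = y := by
  obtain ⟨hd, hval⟩ := h
  obtain ⟨h0, T, hT, hsol⟩ := hd.2.choose_spec
  exact ⟨_, T, hT, hsol, h0, hval⟩

variable {𝕜 X : Type*} [RCLike 𝕜] [NormedAddCommGroup X] [InnerProductSpace 𝕜 X]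
  [NormedSpace ℝ X]

/-- `u` is a mild solution, defined beyond time `1`, that stays in `K` during `[0, 1]`. -/
def IsArc (A : X →ₗ.[𝕜] X) {B : X →ₗ.[𝕜] X} {α : ℝ} (g : FracSpace B α → X)
    (K : Set (FracSpace B α)) (u : ℝ → FracSpace B α) : Prop :=
  (∃ T, 1 < T ∧ IsMildSolution A g T u) ∧ ∀ s ∈ Icc (0 : ℝ) 1, u s ∈ K

variable {A : X →ₗ.[𝕜] X} {k α C : ℝ} {S P D : ℝ → X →L[𝕜] X} {J R Q : X →L[𝕜] X}
  [CompleteSpace X]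

/-- The time one map along arcs in a compact set `K` takes values in `D(A)`, and it is continuous
into `X^1`: it has the modulus of continuity `d ↦ a d + b √d`. -/
theorem IsParabolic.exists_modulus (hp : IsParabolic A k α C S P D J R Q)
    (hα : α ∈ Ico (0 : ℝ) 1) {g : FracSpace (shift A k) α → X} (hg : LipschitzOnBounded g)
    {K : Set (FracSpace (shift A k) α)} (hK : IsCompact K) :
    ∃ a b : ℝ, ∀ u u', IsArc A g K u → IsArc A g K u' → ∃ z z', R z = (u 1).incl ∧
      R z' = (u' 1).incl ∧ ‖z - z'‖ ≤ a * dist (u 0) (u' 0) + b * √(dist (u 0) (u' 0)) := by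
  have hC : 0 ≤ C := zero_le_one.trans hp.one_le
  obtain ⟨L, hL⟩ := hg K hK.isBounded
  obtain ⟨M₁, hM₁⟩ := hK.exists_bound_of_continuousOn hg.continuous.continuousOn
  obtain ⟨M₂, hM₂⟩ := hK.exists_bound_of_continuousOn
    (FracSpace.continuous_pow (B := shift A k) (α := α)).continuousOn
  set M := max (max M₁ M₂) 0 with hM
  have hM0 : 0 ≤ M := le_max_right _ _
  have hgM : ∀ x ∈ K, ‖g x‖ ≤ M := fun x hx =>
    (hM₁ x hx).trans ((le_max_left _ _).trans (le_max_left _ _))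
  have hpM : ∀ x ∈ K, ‖x.pow‖ ≤ M := fun x hx =>
    (hM₂ x hx).trans ((le_max_right _ _).trans (le_max_left _ _))
  obtain ⟨Λ, hΛ0, hΛ⟩ := hp.exists_lipschitz hα.2 L.2
  set θ := (1 - α) / 2 with hθ
  have hθ0 : 0 < θ := by rw [hθ]; linarith [hα.2]
  have hθ1 : θ ≤ 1 := by rw [hθ]; linarith [hα.1]
  set H := L * (C * M * (2 + 2 / θ)) + 4 * M with hH
  have hL0 : (0 : ℝ) ≤ L := L.2
  have hH0 : 0 ≤ H := by positivity
  have hvoc : ∀ u, IsArc A g K u → IsVOC S P 1 (fun s => (u s).pow) (fun s => g (u s)) := by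
    rintro u ⟨⟨T, hT, hu⟩, -⟩
    exact hp.isVOC hα.2 hg.continuous hu hT le_rfl
  have hlip : ∀ x ∈ K, ∀ y ∈ K, ‖g x - g y‖ ≤ L * ‖x.pow - y.pow‖ := fun x hx y hy => by
    have := hL.dist_le_mul x hx y hy
    rwa [dist_eq_norm, FracSpace.dist_eq] at this
  have hholder : ∀ u, IsArc A g K u → ∀ s ∈ Icc (0 : ℝ) 1,
      ‖g (u s) - g (u 1)‖ ≤ H * (1 - s) ^ θ := by
    intro u hu s hs
    have hK1 := hu.2 1 ⟨zero_le_one, le_rfl⟩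
    have hK0 := hu.2 0 ⟨le_rfl, zero_le_one⟩
    have h0 : 0 ≤ 1 - s := by linarith [hs.2]
    have hr0 : 0 ≤ (1 - s) ^ θ := Real.rpow_nonneg h0 _
    rcases le_total s (1 / 2) with h | h
    · have h1 : (1 : ℝ) / 2 ≤ (1 - s) ^ θ := by
        calc (1 : ℝ) / 2 ≤ 1 - s := by linarith
          _ = (1 - s) ^ (1 : ℝ) := (Real.rpow_one _).symm
          _ ≤ (1 - s) ^ θ :=
            Real.rpow_le_rpow_of_exponent_ge (by linarith) (by linarith [hs.1]) hθ1
      calc _ ≤ ‖g (u s)‖ + ‖g (u 1)‖ := _root_.norm_sub_le _ _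
        _ ≤ 4 * M * (1 / 2) := by linarith [hgM _ (hu.2 s hs), hgM _ hK1]
        _ ≤ 4 * M * (1 - s) ^ θ := by gcongr
        _ ≤ H * (1 - s) ^ θ := by
            gcongr
            rw [hH]
            have : 0 ≤ L * (C * M * (2 + 2 / θ)) := by positivity
            linarith
    · have h1 := hp.norm_sub_le hα hθ hM0 (hvoc u hu) (hpM _ hK0)
        (fun s hs => hgM _ (hu.2 s hs)) ⟨h, hs.2⟩
      calc _ ≤ L * ‖(u s).pow - (u 1).pow‖ := hlip _ (hu.2 s hs) _ hK1
        _ ≤ L * (C * M * (2 + 2 / θ) * (1 - s) ^ θ) := by gcongr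
        _ = L * (C * M * (2 + 2 / θ)) * (1 - s) ^ θ := by ring
        _ ≤ H * (1 - s) ^ θ := by
            gcongr
            rw [hH]; linarith
  have hreg : ∀ u, IsArc A g K u →
      R (regularValue D Q (u 0).incl fun s => g (u s)) = (u 1).incl := by
    intro u hu
    rw [← hp.eq_regularValue hθ0 (hvoc u hu).cont_forcing (hholder u hu)]
    obtain ⟨⟨T, hT, hu'⟩, -⟩ := hu
    rw [hu'.2 1 ⟨zero_le_one, hT⟩, hp.semigroup_eq 1 zero_le_one]
    congr 1
    refine intervalIntegral.integral_congr fun s hs => ?_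
    rw [uIcc_of_le zero_le_one] at hs
    simp only [hp.semigroup_eq (1 - s) (sub_nonneg.2 hs.2)]
  refine ⟨C * ‖J‖ + ‖Q‖ * (L * Λ), C * (2 * (√H * √(L * Λ))) * (2 / θ), fun u u' hu hu' =>
    ⟨_, _, hreg u hu, hreg u' hu', ?_⟩⟩
  set d := dist (u 0) (u' 0) with hd
  have hd0 : 0 ≤ d := dist_nonneg
  have hd' : d = ‖(u 0).pow - (u' 0).pow‖ := FracSpace.dist_eq _ _
  have hdiff : ∀ s ∈ Icc (0 : ℝ) 1, ‖g (u s) - g (u' s)‖ ≤ L * Λ * d := fun s hs => by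
    have h1 := hΛ 1 _ _ _ _ le_rfl (hvoc u hu) (hvoc u' hu')
      (fun r hr => hlip _ (hu.2 r hr) _ (hu'.2 r hr)) s hs
    rw [← hd'] at h1
    calc _ ≤ L * ‖(u s).pow - (u' s).pow‖ := hlip _ (hu.2 s hs) _ (hu'.2 s hs)
      _ ≤ L * (Λ * d) := by gcongr
      _ = _ := by ring
  have h1 := hp.norm_regularValue_sub_le hθ0 hH0 (by positivity) (hvoc u hu).cont_forcing
    (hvoc u' hu').cont_forcing (hholder u hu) (hholder u' hu') hdiff (u 0).incl (u' 0).incl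
  refine h1.trans ?_
  have h2 : ‖(u 0).incl - (u' 0).incl‖ ≤ ‖J‖ * d := by
    rw [← hp.J_pow, ← hp.J_pow, ← map_sub, hd']
    exact J.le_opNorm _
  rw [Real.sqrt_mul (by positivity) d]
  calc _ ≤ C * (‖J‖ * d) + C * (2 * (√H * (√(L * Λ) * √d))) * (2 / θ) + ‖Q‖ * (L * Λ * d) := by
        gcongr
    _ = _ := by ring

/-- If every point of the compact set `K` is the initial point of an arc in `K`, and the end point
of one, then `K` is compact in `X^1`, as the image of `K` under the time one map. -/
theorem IsParabolic.isCompact_of_arcs (hp : IsParabolic A k α C S P D J R Q)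
    (hα : α ∈ Ico (0 : ℝ) 1) {g : FracSpace (shift A k) α → X} (hg : LipschitzOnBounded g)
    {K : Set (FracSpace (shift A k) α)} (hK : IsCompact K)
    (hstart : ∀ x ∈ K, ∃ u, IsArc A g K u ∧ u 0 = x)
    (hend : ∀ x ∈ K, ∃ u, IsArc A g K u ∧ u 1 = x) :
    FracSpace.incl '' K ⊆ (A.domain : Set X) ∧
      IsCompact {v : FracSpace (shift A k) 1 | v.incl ∈ FracSpace.incl '' K} := by
  obtain ⟨a, b, hab⟩ := hp.exists_modulus hα hg hK
  choose U hU hU0 using hstart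
  have hz : ∀ u, IsArc A g K u → ∃ z, R z = (u 1).incl := fun u hu => by
    obtain ⟨z, -, hz, -⟩ := hab u u hu hu
    exact ⟨z, hz⟩
  have hmem : ∀ u, IsArc A g K u → (u 1).incl ∈ range (negPow (shift A k) 1) := fun u hu => by
    obtain ⟨z, hz⟩ := hz u hu
    exact ⟨z, by rw [hp.negPow_one, hz]⟩
  have hpow : ∀ (v : FracSpace (shift A k) 1) z, R z = v.incl → v.pow = z := fun v z h =>
    hp.R_inj (by rw [h, ← hp.negPow_one, FracSpace.negPow_pow])
  refine ⟨?_, ?_⟩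
  · rintro _ ⟨x, hx, rfl⟩
    obtain ⟨u, hu, rfl⟩ := hend x hx
    obtain ⟨z, hz⟩ := hz u hu
    rw [← hp.range_R]
    exact ⟨z, hz⟩
  · set Φ : K → FracSpace (shift A k) 1 := fun x => ⟨(U x.1 x.2 1).incl, hmem _ (hU x.1 x.2)⟩
    have hΦ : Continuous Φ := by
      rw [continuous_iff_continuousAt]
      intro y
      have h1 : Tendsto (fun x : K => a * dist x y + b * √(dist x y)) (𝓝 y) (𝓝 0) := by
        have : Continuous fun x : K => a * dist x y + b * √(dist x y) := by fun_prop
        simpa using this.tendsto y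
      refine tendsto_iff_dist_tendsto_zero.2 (squeeze_zero (fun _ => dist_nonneg) (fun x => ?_) h1)
      obtain ⟨z, z', h2, h3, h4⟩ := hab _ _ (hU x.1 x.2) (hU y.1 y.2)
      rw [FracSpace.dist_eq, hpow (Φ x) z h2, hpow (Φ y) z' h3]
      rw [hU0, hU0] at h4
      exact h4
    have hcpt : CompactSpace K := isCompact_iff_compactSpace.1 hK
    convert isCompact_range hΦ using 1
    ext v
    constructor
    · rintro ⟨x, hx, hxv⟩
      obtain ⟨u, hu, rfl⟩ := hend x hx
      have hu0 := hu.2 0 ⟨le_rfl, zero_le_one⟩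
      refine ⟨⟨u 0, hu0⟩, Subtype.ext ?_⟩
      change (U (u 0) hu0 1).incl = v.incl
      rw [← hxv]
      obtain ⟨T, hT, hsol⟩ := hu.1
      obtain ⟨T', hT', hsol'⟩ := (hU (u 0) hu0).1
      rw [hp.mild_unique hα.2 hg hsol' hsol (hU0 _ _) zero_le_one le_rfl hT' hT]
    · rintro ⟨x, rfl⟩
      exact ⟨_, (hU x.1 x.2).2 1 ⟨zero_le_one, le_rfl⟩, rfl⟩

variable [IsScalarTower ℝ 𝕜 X]

/-- The solution that leads from `σ(t)` to `σ(t + 1)` stays in `K` in between, by uniqueness. -/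
theorem IsParabolic.exists_isArc (hp : IsParabolic A k α C S P D J R Q) (hα : α < 1)
    {g : FracSpace (shift A k) α → X} (hg : LipschitzOnBounded g)
    {K : Set (FracSpace (shift A k) α)} {σ : ℝ → FracSpace (shift A k) α}
    (hσ : IsFullSolution (localSemiflow (IsClassicalSolution A g)) σ ∨
      IsFullSolution (localSemiflow (IsMildSolution A g)) σ)
    (hK : ∀ t, σ t ∈ K) (t : ℝ) : ∃ u, IsArc A g K u ∧ u 0 = σ t ∧ u 1 = σ (t + 1) := by
  have key : ∀ s, 0 ≤ s → ∃ u T, s < T ∧ IsMildSolution A g T u ∧ u 0 = σ t ∧ u s = σ (t + s) := by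
    intro s hs
    rcases hσ with h | h
    · obtain ⟨u, T, hT, hu, h0, h1⟩ := exists_solution_of_mem_localSemiflow (h t s hs)
      exact ⟨u, T, hT, hp.isMildSolution hg.continuous hu, h0, h1⟩
    · exact exists_solution_of_mem_localSemiflow (h t s hs)
  obtain ⟨u, T, hT, hu, hu0, hu1⟩ := key 1 zero_le_one
  refine ⟨u, ⟨⟨T, hT, hu⟩, fun s hs => ?_⟩, hu0, hu1⟩
  obtain ⟨u', T', hT', hu', hu0', hu1'⟩ := key s hs.1
  rw [hp.mild_unique hα hg hu hu' (hu0.trans hu0'.symm) hs.1 hs.2 (hs.2.trans_lt hT) hT', hu1']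
  exact hK _

end Invariant

end Parabolic

end

theorem theorem3p2 {𝕜 X : Type*} [RCLike 𝕜] [NormedAddCommGroup X] [InnerProductSpace 𝕜 X]
    [CompleteSpace X] [NormedSpace ℝ X] [IsScalarTower ℝ 𝕜 X]
    (A : X →ₗ.[𝕜] X) (hA : IsSelfAdjoint A) (hbdd : Parabolic.BoundedBelow A)
    (k : ℝ) (hk : 0 ≤ k)
    (hspec : ∀ z ∈ Parabolic.spectrum (Parabolic.shift A k), 0 < RCLike.re z)
    (α : ℝ) (hα : α ∈ Set.Ico (0 : ℝ) 1)
    (g : Parabolic.FracSpace (Parabolic.shift A k) α → X)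
    (hg : Parabolic.LipschitzOnBounded g)
    (K : Set (Parabolic.FracSpace (Parabolic.shift A k) α)) (hK : IsCompact K)
    (hinv : Parabolic.IsInvariant
        (Parabolic.localSemiflow (Parabolic.IsClassicalSolution A g)) K ∨
      Parabolic.IsInvariant
        (Parabolic.localSemiflow (Parabolic.IsMildSolution A g)) K) :
    Set.range (Parabolic.FracSpace.incl :
        Parabolic.FracSpace (Parabolic.shift A k) 1 → X) = (A.domain : Set X) ∧
    Parabolic.FracSpace.incl '' K ⊆ (A.domain : Set X) ∧
    IsCompact {v : Parabolic.FracSpace (Parabolic.shift A k) 1 |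
      v.incl ∈ Parabolic.FracSpace.incl '' K} := by
  obtain ⟨C, S, P, D, J, R, Q, hp⟩ := Parabolic.exists_isParabolic hA hk hspec hα
  have hfull : ∀ x ∈ K, ∃ σ : ℝ → Parabolic.FracSpace (Parabolic.shift A k) α,
      (Parabolic.IsFullSolution (Parabolic.localSemiflow (Parabolic.IsClassicalSolution A g)) σ ∨
        Parabolic.IsFullSolution (Parabolic.localSemiflow (Parabolic.IsMildSolution A g)) σ) ∧
      (∀ t, σ t ∈ K) ∧ σ 0 = x := fun x hx => by
    rcases hinv with h | h
    · obtain ⟨σ, h1, h2⟩ := h x hx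
      exact ⟨σ, .inl h1, h2⟩
    · obtain ⟨σ, h1, h2⟩ := h x hx
      exact ⟨σ, .inr h1, h2⟩
  refine ⟨hp.range_incl_one, hp.isCompact_of_arcs hα hg hK (fun x hx => ?_) fun x hx => ?_⟩
  · obtain ⟨σ, hσ, hσK, rfl⟩ := hfull x hx
    obtain ⟨u, hu, h0, -⟩ := hp.exists_isArc hα.2 hg hσ hσK 0
    exact ⟨u, hu, h0⟩
  · obtain ⟨σ, hσ, hσK, rfl⟩ := hfull x hx
    obtain ⟨u, hu, -, h1⟩ := hp.exists_isArc hα.2 hg hσ hσK (-1)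
    exact ⟨u, hu, by rw [h1, neg_add_cancel]⟩
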